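/- **Setting.** Let $M,K,R\ge 1$ be integers, $T=KR$, and $H,B>0$, $Q,\tau,\zeta,\sigma_2,\sigma_4\ge 0$. A problem instance on $\mathbb R^d$ consists of differentiable objectives $F_1,\dots,F_M:\mathbb R^d\to\mathbb R$ with average $F=\frac1M\sum_m F_m$, probability distributions $\mathcal D_1,\dots,\mathcal D_M$, and for each machine $m$ a stochastic first-order oracle, which at $x$ draws $z\sim\mathcal D_m$ and returns a value $s^m_z(x)$ and a gradient $g^m_z(x)$ with expectations $F_m(x)$ and $\nabla F_m(x)$. (For a loss $f$: $F_m=\mathbb E_{z\sim\mathcal D_m}f(\cdot;z)$ and $g^m_z=\nabla f(\cdot;z)$.) Write $S^\star=\arg\min F$. Assume, for all $m,n\in[M]$ and $x,y\in\mathbb R^d$: 1. (convexity) $F_m(x)+\langle\nabla F_m(x),y-x\rangle\le F_m(y)$; 2. (second-order smoothness) $F_m(y)\le F_m(x)+\langle\nabla F_m(x),y-x\rangle+\frac H2\|x-y\|^2$; 3. (third-order smoothness) $F_m$ is $C^2$ and $\|\nabla^2F_m(x)-\nabla^2F_m(y)\|\le Q\|x-y\|$; 4. (second moment) $\mathbb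 E_{z\sim\mathcal D_m}\|g^m_z(x)-\nabla F_m(x)\|^2\le\sigma_{2,m}^2$, where $\frac1M\sum_m\sigma_{2,m}^2=\sigma_2^2$; 5. (fourth moment) $\mathbb E_{z\sim\mathcal D_m}\|g^m_z(x)-\nabla F_m(x)\|^4\le\sigma_{4,m}^4$, where $\frac1M\sum_m\sigma_{4,m}^4=\sigma_4^4$; 6. (bounded optima) every $F_m$ has a minimizer, and $F$ has a minimizer of norm at most $B$; 7. (second-order heterogeneity) $\|\nabla^2F_m(x)-\nabla^2F_n(x)\|\le\tau$; 8. (uniform first-order heterogeneity) $\|\nabla F_m(x)-\nabla F_n(x)\|\le H\zeta$. **Algorithm.** For $\mu>0$ let $F_{m,\mu}(x)=F_m(x)+\frac\mu2\|x\|^2$, with stochastic gradients $g^m_z(x)+\mu x$. Local SGD on the regularized problem with step-size $\eta$ starts at $x_0^m=0$ and uses independent samples $z_t^m\sim\mathcal D_m$, $0\le t<T$, $m\in[M]$. With $y_{t+1}^m=x_t^m-\eta\,(g^m_{z_t^m}(x_t^m)+\mu x_t^m)$ it sets $x_{t+1}^m=y_{t+1}^m$ if $K\nmid t+1$, and $x_{t+1}^m=\frac1M\sum_n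 y_{t+1}^n$ if $K\mid t+1$. Let $x_t=\frac1M\sum_m x_t^m$ and $$\hat x=\frac1W\sum_{t=0}^{T-1}w_tx_t,\qquad w_t=\Big(1-\frac{\eta\mu}2\Big)^{T-1-t},\qquad W=\sum_{t=0}^{T-1}w_t .$$ **Theorem.** There are universal constants $c,C>0$ such that for all $M,K,R,H,B,Q,\tau,\zeta,\sigma_2,\sigma_4$ as above with $$R\ \ge\ c\left(\frac1K+\frac{\sigma_2^2}{H^2B^2MK}+\frac{\tau\zeta}{BH}+\frac{Q\zeta^2}{HB}+\frac{\tau\sigma_2}{H^2B\sqrt K}+\frac{\sigma_2Q^{1/2}}{H^{3/2}\sqrt{BK}}+\frac{Q^{1/2}\sigma_4}{H^{3/2}\sqrt B\,K^{3/4}}\right)$$ there are a step-size $\eta>0$ and a regularization strength $\mu>0$ with $\eta\mu<2$, depending only on these parameters, such that for every dimension $d$, every problem instance satisfying 1–8, and every $x^\star\in S^\star$, $F(\hat x)$ is integrable and $$\begin{aligned}\mathbb E[F(\hat x)]-F(x^\star)\ \le\ C\,(1+\ln(KR))\bigg(&\frac{HB^2}{KR}+\frac{\tau^{1/2}H^{1/2}\zeta^{1/2}B^{3/2}}{R^{1/2}}+\frac{\tau^{1/2}\sigma_2^{1/2}B^{3/2}}{K^{1/4}R^{1/2}}+\frac{Q^{1/3}B^{5/3}H^{2/3}\zeta^{2/3}}{R^{2/3}}\\&+\frac{Q^{1/3}B^{5/3}\sigma_2^{2/3}}{K^{1/3}R^{2/3}}+\frac{Q^{1/3}B^{5/3}\sigma_4^{2/3}}{K^{1/2}R^{2/3}}+\frac{\sigma_2B}{\sqrt{MKR}}\bigg).\end{aligned}$$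 -/

import Mathlib

open MeasureTheory ProbabilityTheory Gradient

/-- The space `ℝ^d` with its Euclidean norm and inner product. -/
abbrev Vec (d : ℕ) : Type := EuclideanSpace ℝ (Fin d)

/-- A distributed stochastic optimization problem on `ℝ^d` with `M` machines and data space `Z`.
Machine `m` has a differentiable objective `F m`, a data distribution `dist m`, and a stochastic
first-order oracle: at the point `x` it draws `z ∼ dist m` and returns the pair
`(val m x z, grad m x z)`, whose expectation is `(F m x, ∇ (F m) x)`.
The choice `val m x z = f (x; z)`, `grad m x z = ∇ₓ f (x; z)`, `F m x = 𝔼 f (x; z)`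
is the case of a loss function `f`. -/
structure FedProblem (d M : ℕ) (Z : Type*) [MeasurableSpace Z] where
  dist : Fin M → Measure Z
  isProb : ∀ m, IsProbabilityMeasure (dist m)
  F : Fin M → Vec d → ℝ
  differentiable : ∀ m, Differentiable ℝ (F m)
  val : Fin M → Vec d → Z → ℝ
  grad : Fin M → Vec d → Z → Vec d
  integrable_val : ∀ m x, Integrable (val m x) (dist m)
  integral_val : ∀ m x, ∫ z, val m x z ∂(dist m) = F m x
  measurable_grad : ∀ m, Measurable fun p : Vec d × Z => grad m p.1 p.2
  integrable_grad : ∀ m x, Integrable (grad m x) (dist m)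
  integral_grad : ∀ m x, ∫ z, grad m x z ∂(dist m) = ∇ (F m) x

/-- The iterates `x_t^m` of (vanilla) Local SGD started at `0`, with step-size `η`, `K` local steps
per communication round, stochastic gradients `g m x z`, and samples `z t m` drawn at time `t` on
machine `m`: every machine makes an SGD step, and the results are averaged over the machines
whenever `t + 1` is a multiple of `K`. -/
noncomputable def localSGD {d M : ℕ} {Z : Type*} (g : Fin M → Vec d → Z → Vec d) (η : ℝ) (K : ℕ)
    (z : ℕ → Fin M → Z) : ℕ → Fin M → Vec d
  | 0 => fun _ => 0
  | t + 1 => fun m =>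
      if (t + 1) % K = 0 then
        (1 / (M : ℝ)) • ∑ n, (localSGD g η K z t n - η • g n (localSGD g η K z t n) (z t n))
      else
        localSGD g η K z t m - η • g m (localSGD g η K z t m) (z t m)

namespace FedProblem

variable {d M : ℕ} {Z : Type*} [MeasurableSpace Z] (P : FedProblem d M Z)

/-- The average objective `F = (1/M) ∑ₘ F_m`. -/
noncomputable def avg (x : Vec d) : ℝ := (1 / (M : ℝ)) * ∑ m, P.F m x

/-- The set `S_m⋆` of minimizers of the objective of machine `m`. -/
def optimaOf (m : Fin M) : Set (Vec d) := {x | ∀ y, P.F m x ≤ P.F m y}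

/-- The set `S⋆` of minimizers of the average objective. -/
def optima : Set (Vec d) := {x | ∀ y, P.avg x ≤ P.avg y}

/-- The Hessian `∇² F_m (x)`, as a linear map; its norm is the spectral norm. -/
noncomputable def hessian (m : Fin M) (x : Vec d) : Vec d →L[ℝ] Vec d :=
  fderiv ℝ (∇ (P.F m)) x

/-- Convexity of all objectives. -/
def Convex : Prop :=
  ∀ m x y, P.F m x + inner ℝ (∇ (P.F m) x) (y - x) ≤ P.F m y

/-- Second-order smoothness of all objectives, with constant `H`. -/
def SecondOrderSmooth (H : ℝ) : Prop :=
  ∀ m x y, P.F m y ≤ P.F m x + inner ℝ (∇ (P.F m) x) (y - x) + H / 2 * ‖x - y‖ ^ 2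

/-- Third-order smoothness of all objectives: twice continuously differentiable, with a
`Q`-Lipschitz Hessian. -/
def ThirdOrderSmooth (Q : ℝ) : Prop :=
  ∀ m, ContDiff ℝ 2 (P.F m) ∧ ∀ x y, ‖P.hessian m x - P.hessian m y‖ ≤ Q * ‖x - y‖

/-- The gradient noise of machine `m` has second moment at most `s m ^ 2` at every point, where
the `s m ^ 2` have average `σ₂ ^ 2`. -/
def BoundedSecondMoment (σ₂ : ℝ) : Prop :=
  ∃ s : Fin M → ℝ, (∀ m, 0 ≤ s m) ∧ (1 / (M : ℝ)) * ∑ m, s m ^ 2 = σ₂ ^ 2 ∧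
    ∀ m x, Integrable (fun z => ‖P.grad m x z - ∇ (P.F m) x‖ ^ 2) (P.dist m) ∧
      ∫ z, ‖P.grad m x z - ∇ (P.F m) x‖ ^ 2 ∂(P.dist m) ≤ s m ^ 2

/-- The gradient noise of machine `m` has fourth moment at most `s m ^ 4` at every point, where
the `s m ^ 4` have average `σ₄ ^ 4`. -/
def BoundedFourthMoment (σ₄ : ℝ) : Prop :=
  ∃ s : Fin M → ℝ, (∀ m, 0 ≤ s m) ∧ (1 / (M : ℝ)) * ∑ m, s m ^ 4 = σ₄ ^ 4 ∧
    ∀ m x, Integrable (fun z => ‖P.grad m x z - ∇ (P.F m) x‖ ^ 4) (P.dist m) ∧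
      ∫ z, ‖P.grad m x z - ∇ (P.F m) x‖ ^ 4 ∂(P.dist m) ≤ s m ^ 4

/-- Bounded optima: every machine has a minimizer (with some norm bound `B_m`), and the average
objective has a minimizer of norm at most `B`. -/
def BoundedOptima (B : ℝ) : Prop :=
  (∀ m, ∃ Bm : ℝ, ∃ x ∈ P.optimaOf m, ‖x‖ ≤ Bm) ∧ ∃ x ∈ P.optima, ‖x‖ ≤ B

/-- Second-order heterogeneity at most `τ`. -/
def SecondOrderHeterogeneity (τ : ℝ) : Prop :=
  ∀ m n x, ‖P.hessian m x - P.hessian n x‖ ≤ τ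

/-- Uniform first-order heterogeneity at most `H ζ`. -/
def UniformFirstOrderHeterogeneity (H ζ : ℝ) : Prop :=
  ∀ m n x, ‖∇ (P.F m) x - ∇ (P.F n) x‖ ≤ H * ζ

/-- The samples `z t m` are independent over all times `t` and machines `m`, and `z t m` has
law `dist m`. -/
structure IsSampling {Ω : Type*} [MeasurableSpace Ω] (ν : Measure Ω)
    (z : ℕ → Fin M → Ω → Z) : Prop where
  measurable : ∀ t m, Measurable (z t m)
  law : ∀ t m, ν.map (z t m) = P.dist m
  indep : iIndepFun (fun p : ℕ × Fin M => z p.1 p.2) ν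

theorem hasGradientAt_regularized {f : Vec d → ℝ} (hf : Differentiable ℝ f) (μ : ℝ) (x : Vec d) :
    HasGradientAt (fun y => f y + μ / 2 * ‖y‖ ^ 2) (∇ f x + μ • x) x := by
  rw [hasGradientAt_iff_hasFDerivAt]
  have h1 : HasFDerivAt f (InnerProductSpace.toDual ℝ (Vec d) (∇ f x)) x :=
    ((hf x).hasGradientAt).hasFDerivAt
  have h2 := ((hasStrictFDerivAt_norm_sq x).hasFDerivAt).const_mul (μ / 2)
  refine (h1.add h2).congr_fderiv ?_
  ext v
  simp
  ring

/-- The `ℓ²`-regularized problem, with objectives `F_m(x) + (μ/2) ‖x‖²` and the corresponding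
oracles. -/
noncomputable def regularize (μ : ℝ) : FedProblem d M Z where
  dist := P.dist
  isProb := P.isProb
  F m x := P.F m x + μ / 2 * ‖x‖ ^ 2
  differentiable m x := (hasGradientAt_regularized (P.differentiable m) μ x).differentiableAt
  val m x z := P.val m x z + μ / 2 * ‖x‖ ^ 2
  grad m x z := P.grad m x z + μ • x
  integrable_val m x := by
    have := P.isProb m
    exact (P.integrable_val m x).add (integrable_const _)
  integral_val m x := by
    have := P.isProb m
    rw [integral_add (P.integrable_val m x) (integrable_const _), P.integral_val]
    simp
  measurable_grad m := (P.measurable_grad m).add (measurable_fst.const_smul μ)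
  integrable_grad m x := by
    have := P.isProb m
    exact (P.integrable_grad m x).add (integrable_const _)
  integral_grad m x := by
    have := P.isProb m
    rw [integral_add (P.integrable_grad m x) (integrable_const _), P.integral_grad,
      (hasGradientAt_regularized (P.differentiable m) μ x).gradient]
    simp

/-- The averaged iterate `x_t = (1/M) ∑ₘ x_t^m` of Local SGD on the problem `P`. -/
noncomputable def avgIterate (η : ℝ) (K : ℕ) (z : ℕ → Fin M → Z) (t : ℕ) : Vec d :=
  (1 / (M : ℝ)) • ∑ m, localSGD P.grad η K z t m

/-- The weighted iterate `x̂ = (1/W) ∑_{t < T} w_t x_t` of Local SGD on the problem `P`, with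
`w_t = (1 - η μ / 2)^(T - 1 - t)` and `W = ∑_{t < T} w_t`, where `T = K R`. -/
noncomputable def weightedIterate (η μ : ℝ) (K R : ℕ) (z : ℕ → Fin M → Z) : Vec d :=
  (1 / ∑ t ∈ Finset.range (K * R), (1 - η * μ / 2) ^ (K * R - 1 - t)) •
    ∑ t ∈ Finset.range (K * R), (1 - η * μ / 2) ^ (K * R - 1 - t) • P.avgIterate η K z t

end FedProblem

/-! Averaging the local steps gives a gradient step on the regularized average objective, perturbed
by a bias (`gradBias`) and by averaged noise of variance at most `σ₂ ^ 2 / M`. The argument controls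
the bias and pays for it with the strong convexity that regularization creates.

The bias is small because deviations from the mean sum to zero. After Taylor expansion at the mean,
a Hessian common to all machines therefore drops out; only Hessian differences (at most `τ`) and a
quadratic remainder (constant `Q`) survive. So the squared bias is bounded by `dispersion` and its
square (`norm_gradBias_sq_le`), and the square is where fourth moments enter. Dispersion vanishes at
each communication. In between, damped gradient steps are nonexpansive, so it is fed only by
heterogeneity `η * H * ζ` and noise; Young's inequality with weight `K` costs a factor `1 + 1 / K`
per step, bounded over a round (`integral_dispersion_le`, `integral_dispersion_sq_le`).

The distance to a minimizer of the unregularized average contracts by `1 - η * μ / 2`, with costs `η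
* μ * B ^ 2` for regularizing and `η / μ` times the squared bias (`norm_famMean_drift_sub_sq_le`).
The geometric weights telescope this recursion. With `η = 1 / (μ * K * R)` and `μ * B ^ 2` equal to
eight times the sum of the target terms, every error is at most a constant times `μ * B ^ 2`
(`local_error_terms_le`). -/

/-! ### Gradient steps on smooth convex functions. -/

section SmoothConvex

variable {E : Type*} [NormedAddCommGroup E] [InnerProductSpace ℝ E] {f : E → ℝ} {g : E → E} {H : ℝ}

theorem norm_sq_le_of_smooth (hH : 0 < H)
    (hs : ∀ x y, f y ≤ f x + inner ℝ (g x) (y - x) + H / 2 * ‖x - y‖ ^ 2) {b : ℝ}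
    (hb : ∀ y, b ≤ f y) (x : E) : ‖g x‖ ^ 2 ≤ 2 * H * (f x - b) := by
  have h1 := hs x (x - (1 / H) • g x)
  have h2 := hb (x - (1 / H) • g x)
  rw [sub_sub_cancel, sub_sub_cancel_left, inner_neg_right, real_inner_smul_right,
    real_inner_self_eq_norm_sq, norm_smul, Real.norm_of_nonneg (by positivity)] at h1
  have h3 : -(1 / H * ‖g x‖ ^ 2) + H / 2 * (1 / H * ‖g x‖) ^ 2 = -(‖g x‖ ^ 2 / (2 * H)) := by
    field_simp; ring
  have h4 : ‖g x‖ ^ 2 / (2 * H) ≤ f x - b := by linarith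
  rwa [div_le_iff₀ (by positivity), mul_comm] at h4

/-- Evaluate `f` at `x - (1 / H) • (g x - g y)`: smoothness from `x` bounds it above, convexity from
`y` bounds it below. -/
theorem gradient_gap_of_convex_smooth (hH : 0 < H)
    (hc : ∀ x y, f x + inner ℝ (g x) (y - x) ≤ f y)
    (hs : ∀ x y, f y ≤ f x + inner ℝ (g x) (y - x) + H / 2 * ‖x - y‖ ^ 2) (x y : E) :
    f y + inner ℝ (g y) (x - y) + 1 / (2 * H) * ‖g x - g y‖ ^ 2 ≤ f x := by
  set δ := g x - g y with hδ
  have h1 := hs x (x - (1 / H) • δ)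
  have h2 := hc y (x - (1 / H) • δ)
  rw [sub_sub_cancel, sub_sub_cancel_left, inner_neg_right, real_inner_smul_right,
    norm_smul, Real.norm_of_nonneg (by positivity)] at h1
  rw [sub_right_comm, inner_sub_right, real_inner_smul_right] at h2
  have h3 : inner ℝ (g x) δ - inner ℝ (g y) δ = ‖δ‖ ^ 2 := by
    rw [← inner_sub_left, ← hδ, real_inner_self_eq_norm_sq]
  have h4 : 1 / H * inner ℝ (g x) δ - 1 / H * inner ℝ (g y) δ = 1 / H * ‖δ‖ ^ 2 := by
    rw [← h3]; ring
  have h5 : H / 2 * (1 / H * ‖δ‖) ^ 2 = 1 / H * ‖δ‖ ^ 2 - 1 / (2 * H) * ‖δ‖ ^ 2 := by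
    field_simp; ring
  linarith

theorem cocoercive_of_convex_smooth (hH : 0 < H)
    (hc : ∀ x y, f x + inner ℝ (g x) (y - x) ≤ f y)
    (hs : ∀ x y, f y ≤ f x + inner ℝ (g x) (y - x) + H / 2 * ‖x - y‖ ^ 2) (x y : E) :
    ‖g x - g y‖ ^ 2 ≤ H * inner ℝ (g x - g y) (x - y) := by
  have h1 := gradient_gap_of_convex_smooth hH hc hs x y
  have h2 := gradient_gap_of_convex_smooth hH hc hs y x
  rw [norm_sub_rev (g y), ← neg_sub x y, inner_neg_right] at h2
  rw [inner_sub_left]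
  have h3 : 1 / H * ‖g x - g y‖ ^ 2 ≤ inner ℝ (g x) (x - y) - inner ℝ (g y) (x - y) := by
    have : 1 / (2 * H) = 1 / H / 2 := by field_simp
    rw [this] at h1 h2
    linarith
  rwa [one_div, inv_mul_le_iff₀ hH] at h3

/-- A damped gradient step with a small step-size contracts. -/
theorem norm_damped_step_sub_le (hH : 0 < H)
    (hc : ∀ x y, f x + inner ℝ (g x) (y - x) ≤ f y)
    (hs : ∀ x y, f y ≤ f x + inner ℝ (g x) (y - x) + H / 2 * ‖x - y‖ ^ 2)
    {η a : ℝ} (hη : 0 ≤ η) (ha0 : 0 ≤ a) (ha : a ≤ 1) (hηH : η * H ≤ 2 * a) (x y : E) :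
    ‖(a • x - η • g x) - (a • y - η • g y)‖ ≤ ‖x - y‖ := by
  have h1 := cocoercive_of_convex_smooth hH hc hs x y
  have e : (a • x - η • g x) - (a • y - η • g y) = a • (x - y) - η • (g x - g y) := by
    module
  rw [e]
  refine (sq_le_sq₀ (norm_nonneg _) (norm_nonneg _)).1 ?_
  rw [norm_sub_sq_real, norm_smul, norm_smul, Real.norm_of_nonneg ha0, Real.norm_of_nonneg hη,
    real_inner_smul_left, real_inner_smul_right, real_inner_comm]
  set q : ℝ := inner ℝ (g x - g y) (x - y)
  -- Cocoercivity gives `0 ≤ H * q`. Cocoercivity and `η * H ≤ 2 * a` then let the cross term `-2 *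
  -- a * η * q` absorb the squared gradient difference.
  have hq : 0 ≤ q := by
    by_contra! h
    nlinarith [sq_nonneg ‖g x - g y‖]
  have h2 : η ^ 2 * ‖g x - g y‖ ^ 2 ≤ η ^ 2 * (H * q) := by gcongr
  have h3 : η * q * (η * H) ≤ η * q * (2 * a) := by gcongr
  have h4 : a ^ 2 * ‖x - y‖ ^ 2 ≤ 1 * ‖x - y‖ ^ 2 := by
    gcongr; nlinarith
  nlinarith

end SmoothConvex

/-! ### Means and dispersions of finite families. -/

section Dispersion

variable {E : Type*} [NormedAddCommGroup E] [InnerProductSpace ℝ E] {M : ℕ}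

/-- The mean of a finite family of vectors. -/
noncomputable def famMean (x : Fin M → E) : E := (1 / (M : ℝ)) • ∑ m, x m

/-- The mean square deviation of a finite family of vectors from its mean. -/
noncomputable def dispersion (x : Fin M → E) : ℝ := (1 / (M : ℝ)) * ∑ m, ‖x m - famMean x‖ ^ 2

/-- The covariance of two finite families of vectors. -/
noncomputable def famCov (x y : Fin M → E) : ℝ :=
  (1 / (M : ℝ)) * ∑ m, inner ℝ (x m - famMean x) (y m)

theorem sum_eq_smul_famMean (hM : 0 < M) (x : Fin M → E) : ∑ m, x m = (M : ℝ) • famMean x := by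
  have : (M : ℝ) ≠ 0 := by positivity
  rw [famMean, smul_smul, mul_one_div_cancel this, one_smul]

theorem sum_sub_famMean (hM : 0 < M) (x : Fin M → E) : ∑ m, (x m - famMean x) = 0 := by
  rw [Finset.sum_sub_distrib, sum_eq_smul_famMean hM]
  simp [← Nat.cast_smul_eq_nsmul ℝ]

theorem famMean_sub_smul (x y : Fin M → E) (c : ℝ) :
    famMean (fun m => x m - c • y m) = famMean x - c • famMean y := by
  simp only [famMean, Finset.sum_sub_distrib, ← Finset.smul_sum]
  module

theorem famMean_const (hM : 0 < M) (c : E) : famMean (fun _ : Fin M => c) = c := by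
  have : (M : ℝ) ≠ 0 := by positivity
  simp [famMean, ← Nat.cast_smul_eq_nsmul ℝ, smul_smul, this]

theorem dispersion_const (hM : 0 < M) (c : E) : dispersion (fun _ : Fin M => c) = 0 := by
  simp [dispersion, famMean_const hM]

theorem dispersion_nonneg (x : Fin M → E) : 0 ≤ dispersion x := by
  unfold dispersion; positivity

theorem mean_norm_sub_sq (hM : 0 < M) (x : Fin M → E) (c : E) :
    (1 / (M : ℝ)) * ∑ m, ‖x m - c‖ ^ 2 = dispersion x + ‖famMean x - c‖ ^ 2 := by
  have hM' : (M : ℝ) ≠ 0 := by positivity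
  have h : ∀ m, ‖x m - c‖ ^ 2 = ‖x m - famMean x‖ ^ 2
      + 2 * inner ℝ (x m - famMean x) (famMean x - c) + ‖famMean x - c‖ ^ 2 := fun m => by
    rw [← norm_add_sq_real, sub_add_sub_cancel]
  simp only [h, Finset.sum_add_distrib, ← Finset.mul_sum, ← sum_inner, sum_sub_famMean hM]
  simp [dispersion, mul_add, hM']

/-- The mean minimizes the mean square distance, so any convenient common reference point may
replace it in upper bounds. -/
theorem dispersion_le (hM : 0 < M) (x : Fin M → E) (c : E) :
    dispersion x ≤ (1 / (M : ℝ)) * ∑ m, ‖x m - c‖ ^ 2 := by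
  rw [mean_norm_sub_sq hM]
  linarith [sq_nonneg ‖famMean x - c‖]

theorem dispersion_le_mean_norm_sq (hM : 0 < M) (x : Fin M → E) :
    dispersion x ≤ (1 / (M : ℝ)) * ∑ m, ‖x m‖ ^ 2 := by
  simpa using dispersion_le hM x 0

theorem famMean_norm_sq_le (hM : 0 < M) (x : Fin M → E) :
    ‖famMean x‖ ^ 2 ≤ (1 / (M : ℝ)) * ∑ m, ‖x m‖ ^ 2 := by
  have := mean_norm_sub_sq hM x 0
  simp only [sub_zero] at this
  linarith [dispersion_nonneg x]

theorem dispersion_sub_smul (hM : 0 < M) (x y : Fin M → E) (c : ℝ) :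
    dispersion (fun m => x m - c • y m)
      = dispersion x - 2 * c * famCov x y + c ^ 2 * dispersion y := by
  have h : ∀ m, ‖x m - c • y m - (famMean x - c • famMean y)‖ ^ 2 =
      ‖x m - famMean x‖ ^ 2 - 2 * c * inner ℝ (x m - famMean x) (y m)
        + 2 * c * inner ℝ (x m - famMean x) (famMean y) + c ^ 2 * ‖y m - famMean y‖ ^ 2 := fun m => by
    have e : x m - c • y m - (famMean x - c • famMean y)
      = (x m - famMean x) - c • (y m - famMean y) := by module
    rw [e, norm_sub_sq_real, real_inner_smul_right, norm_smul, mul_pow, inner_sub_right,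
      Real.norm_eq_abs, sq_abs]
    ring
  simp only [dispersion, famCov, famMean_sub_smul, h, Finset.sum_add_distrib,
    Finset.sum_sub_distrib, ← Finset.mul_sum, ← sum_inner, sum_sub_famMean hM]
  simp
  ring

theorem famCov_sq_le (x y : Fin M → E) :
    famCov x y ^ 2 ≤ dispersion x * ((1 / (M : ℝ)) * ∑ m, ‖y m‖ ^ 2) := by
  have h1 : |∑ m, inner ℝ (x m - famMean x) (y m)| ≤ ∑ m, ‖x m - famMean x‖ * ‖y m‖ :=
    (Finset.abs_sum_le_sum_abs _ _).trans (Finset.sum_le_sum fun m _ => abs_real_inner_le_norm _ _)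
  have h2 := Finset.sum_mul_sq_le_sq_mul_sq Finset.univ (fun m => ‖x m - famMean x‖) (fun m => ‖y m‖)
  have h3 : (∑ m, inner ℝ (x m - famMean x) (y m)) ^ 2
      ≤ (∑ m, ‖x m - famMean x‖ ^ 2) * ∑ m, ‖y m‖ ^ 2 := by
    rw [← sq_abs]
    exact (pow_le_pow_left₀ (abs_nonneg _) h1 2).trans h2
  unfold famCov dispersion
  calc _ = (1 / (M : ℝ)) ^ 2 * (∑ m, inner ℝ (x m - famMean x) (y m)) ^ 2 := by ring
    _ ≤ (1 / (M : ℝ)) ^ 2 * ((∑ m, ‖x m - famMean x‖ ^ 2) * ∑ m, ‖y m‖ ^ 2) := by gcongr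
    _ = _ := by ring

theorem mean_sq_le (hM : 0 < M) (a : Fin M → ℝ) :
    ((1 / (M : ℝ)) * ∑ m, a m) ^ 2 ≤ (1 / (M : ℝ)) * ∑ m, a m ^ 2 := by
  have := famMean_norm_sq_le hM a
  simpa [famMean, smul_eq_mul, mul_pow] using this

/-- The term linear in `famCov u v` is kept exact because it has mean zero when `v` is noise. The
factor 10 collects 2 from the product of `dispersion u` with the dispersion of `v` and 8 from
Cauchy–Schwarz on the squared covariance. -/
theorem dispersion_sub_smul_sq_le (hM : 0 < M) (u v : Fin M → E) (c : ℝ) :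
    dispersion (fun m => u m - c • v m) ^ 2 ≤ dispersion u ^ 2 - 4 * c * dispersion u * famCov u v
      + 10 * c ^ 2 * dispersion u * ((1 / (M : ℝ)) * ∑ m, ‖v m‖ ^ 2)
      + 2 * c ^ 4 * ((1 / (M : ℝ)) * ∑ m, ‖v m‖ ^ 4) := by
  rw [dispersion_sub_smul hM]
  have h1 := famCov_sq_le u v
  have h2 := dispersion_le_mean_norm_sq hM v
  have h3 := mean_sq_le hM fun m => ‖v m‖ ^ 2
  have h0 := dispersion_nonneg v
  have h0' := dispersion_nonneg u
  simp only [← pow_mul] at h3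
  norm_num only at h3
  set U := dispersion u
  set V := famCov u v
  set D := dispersion v
  set N := (1 / (M : ℝ)) * ∑ m, ‖v m‖ ^ 2 with hN
  set N4 := (1 / (M : ℝ)) * ∑ m, ‖v m‖ ^ 4
  have h5 : (c ^ 2 * D - 2 * c * V) ^ 2 ≤ 2 * c ^ 4 * D ^ 2 + 8 * c ^ 2 * V ^ 2 := by
    nlinarith [sq_nonneg (c ^ 2 * D + 2 * c * V)]
  have h6 : 2 * c ^ 4 * D ^ 2 ≤ 2 * c ^ 4 * N4 := by
    gcongr; exact (pow_le_pow_left₀ h0 h2 2).trans h3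
  have h7 : 8 * c ^ 2 * V ^ 2 ≤ 8 * c ^ 2 * (U * N) := by gcongr
  have h8 : 2 * U * (c ^ 2 * D) ≤ 2 * U * (c ^ 2 * N) := by gcongr
  nlinarith

end Dispersion

/-! ### The noiseless local step: bias, dispersion and distance to a minimizer. -/

namespace FedProblem

variable {d M : ℕ} {Z : Type*} [MeasurableSpace Z] (P : FedProblem d M Z)

/-- The gradient of the average objective. -/
noncomputable def avgGrad (x : Vec d) : Vec d := famMean fun m => ∇ (P.F m) x

/-- The deviation of the mean of the local gradients from the gradient at the mean. -/
noncomputable def gradBias (x : Fin M → Vec d) : Vec d :=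
  famMean fun m => ∇ (P.F m) (x m) - ∇ (P.F m) (famMean x)

/-- The noise of the stochastic gradient. -/
noncomputable def noise (m : Fin M) (x : Vec d) (z : Z) : Vec d := P.grad m x z - ∇ (P.F m) x

/-- The noiseless local steps on the regularized problem. -/
noncomputable def drift (η μ : ℝ) (x : Fin M → Vec d) (m : Fin M) : Vec d :=
  (1 - η * μ) • x m - η • ∇ (P.F m) (x m)

/-- The local steps on the regularized problem, before communication. -/
noncomputable def localStep (η μ : ℝ) (x : Fin M → Vec d) (z : Fin M → Z) (m : Fin M) : Vec d :=
  P.drift η μ x m - η • P.noise m (x m) (z m)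

variable {P}

theorem Convex.avg (h : P.Convex) (x y : Vec d) :
    P.avg x + inner ℝ (P.avgGrad x) (y - x) ≤ P.avg y := by
  have h1 : ∑ m, (P.F m x + inner ℝ (∇ (P.F m) x) (y - x)) ≤ ∑ m, P.F m y :=
    Finset.sum_le_sum fun m _ => h m x y
  rw [Finset.sum_add_distrib, ← sum_inner] at h1
  rw [avgGrad, famMean, real_inner_smul_left, FedProblem.avg, FedProblem.avg, ← mul_add]
  gcongr

theorem SecondOrderSmooth.avg {H : ℝ} (hM : 0 < M) (h : P.SecondOrderSmooth H) (x y : Vec d) :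
    P.avg y ≤ P.avg x + inner ℝ (P.avgGrad x) (y - x) + H / 2 * ‖x - y‖ ^ 2 := by
  have h1 : ∑ m, P.F m y ≤ ∑ m, (P.F m x + inner ℝ (∇ (P.F m) x) (y - x) + H / 2 * ‖x - y‖ ^ 2) :=
    Finset.sum_le_sum fun m _ => h m x y
  rw [Finset.sum_add_distrib, Finset.sum_add_distrib, ← sum_inner] at h1
  have h2 := mul_le_mul_of_nonneg_left h1 (show 0 ≤ 1 / (M : ℝ) by positivity)
  have hM' : (M : ℝ) ≠ 0 := by positivity
  rw [avgGrad, famMean, real_inner_smul_left, FedProblem.avg, FedProblem.avg]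
  refine h2.trans_eq ?_
  simp
  field_simp

theorem ThirdOrderSmooth.differentiable_gradient {Q : ℝ} (h : P.ThirdOrderSmooth Q) (m : Fin M) :
    Differentiable ℝ (∇ (P.F m)) := by
  have h1 : Differentiable ℝ (fderiv ℝ (P.F m)) :=
    ((h m).1.fderiv_right (m := 1) (by norm_num)).differentiable (by norm_num)
  exact ((InnerProductSpace.toDual ℝ (Vec d)).symm.differentiable).comp h1

/-- Mean value inequality on the segment, along which the Hessian differs from its value at `x` by
at most `Q * ‖y - x‖`. -/
theorem ThirdOrderSmooth.norm_gradient_sub_sub_le {Q : ℝ} (h : P.ThirdOrderSmooth Q) (hQ : 0 ≤ Q)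
    (m : Fin M) (x y : Vec d) :
    ‖∇ (P.F m) y - ∇ (P.F m) x - P.hessian m x (y - x)‖ ≤ Q * ‖y - x‖ ^ 2 := by
  have h1 := (convex_segment (𝕜 := ℝ) x y).norm_image_sub_le_of_norm_fderiv_le' (𝕜 := ℝ)
    (f := ∇ (P.F m)) (φ := P.hessian m x) (C := Q * ‖y - x‖)
    (fun z _ => h.differentiable_gradient m z) (fun z hz => ((h m).2 z x).trans ?_)
    (left_mem_segment ℝ x y) (right_mem_segment ℝ x y)
  · rw [pow_two, ← mul_assoc]; exact h1
  · gcongr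
    obtain ⟨t, ht, rfl⟩ := (segment_eq_image' ℝ x y ▸ hz)
    simp only [add_sub_cancel_left, norm_smul]
    exact mul_le_of_le_one_left (norm_nonneg _) (by rw [Real.norm_of_nonneg ht.1]; exact ht.2)

theorem norm_gradBias_sq_le (hM : 0 < M) {Q τ : ℝ} (hQ : 0 ≤ Q)
    (h3 : P.ThirdOrderSmooth Q) (h7 : P.SecondOrderHeterogeneity τ) (x : Fin M → Vec d) :
    ‖P.gradBias x‖ ^ 2 ≤ 2 * τ ^ 2 * dispersion x + 2 * Q ^ 2 * dispersion x ^ 2 := by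
  set w := famMean x with hw
  let m₀ : Fin M := ⟨0, hM⟩
  -- The Hessian of an arbitrary reference machine can be subtracted for free, since it is linear
  -- and the deviations from `w` sum to zero.
  have e : P.gradBias x = famMean (fun m => (P.hessian m w - P.hessian m₀ w) (x m - w))
      + famMean (fun m => ∇ (P.F m) (x m) - ∇ (P.F m) w - P.hessian m w (x m - w)) := by
    have : ∑ m, P.hessian m₀ w (x m - w) = 0 := by
      rw [← map_sum, hw, sum_sub_famMean hM, map_zero]
    change famMean (fun m => ∇ (P.F m) (x m) - ∇ (P.F m) w) = _
    simp only [famMean, sub_apply, Finset.sum_sub_distrib, this]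
    module
  have a1 : ‖famMean (fun m => (P.hessian m w - P.hessian m₀ w) (x m - w))‖ ^ 2
      ≤ τ ^ 2 * dispersion x := by
    refine (famMean_norm_sq_le hM _).trans ?_
    rw [dispersion, mul_left_comm (τ ^ 2), Finset.mul_sum _ _ (τ ^ 2)]
    refine mul_le_mul_of_nonneg_left (Finset.sum_le_sum fun m _ => ?_) (by positivity)
    rw [← mul_pow]
    refine pow_le_pow_left₀ (norm_nonneg _) ?_ 2
    exact (ContinuousLinearMap.le_opNorm _ _).trans (by gcongr; exact h7 _ _ _)
  have a2 : ‖famMean (fun m => ∇ (P.F m) (x m) - ∇ (P.F m) w - P.hessian m w (x m - w))‖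
      ≤ Q * dispersion x := by
    rw [famMean, norm_smul, Real.norm_of_nonneg (by positivity), dispersion, mul_left_comm,
      Finset.mul_sum]
    gcongr
    exact (norm_sum_le _ _).trans (Finset.sum_le_sum fun m _ => h3.norm_gradient_sub_sub_le hQ _ _ _)
  have a3 := pow_le_pow_left₀ (norm_nonneg _) a2 2
  rw [e]
  have a4 := parallelogram_law_with_norm ℝ
    (famMean (fun m => (P.hessian m w - P.hessian m₀ w) (x m - w)))
    (famMean (fun m => ∇ (P.F m) (x m) - ∇ (P.F m) w - P.hessian m w (x m - w)))
  nlinarith [mul_self_nonneg ‖famMean (fun m => (P.hessian m w - P.hessian m₀ w) (x m - w))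
    - famMean (fun m => ∇ (P.F m) (x m) - ∇ (P.F m) w - P.hessian m w (x m - w))‖]

/-- Compare every local step with the step of one fixed machine from the mean: moving the base point
is nonexpansive, and changing the machine costs `η * (H * ζ)`. The weight `κ` of Young's inequality
is left free. -/
theorem dispersion_drift_le (hM : 0 < M) {H ζ η μ κ : ℝ} (hH : 0 < H)
    (h1 : P.Convex) (h2 : P.SecondOrderSmooth H) (h8 : P.UniformFirstOrderHeterogeneity H ζ)
    (hη : 0 < η) (hμ : 0 < μ) (hημ : η * μ ≤ 1 / 2) (hηH : η * H ≤ 1) (hκ : 0 < κ)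
    (x : Fin M → Vec d) :
    dispersion (P.drift η μ x) ≤ (1 + 1 / κ) * dispersion x + (1 + κ) * (η * (H * ζ)) ^ 2 := by
  set w := famMean x with hw
  let m₀ : Fin M := ⟨0, hM⟩
  have hb : ∀ m, ‖P.drift η μ x m - ((1 - η * μ) • w - η • ∇ (P.F m₀) w)‖ ^ 2
      ≤ (1 + 1 / κ) * ‖x m - w‖ ^ 2 + (1 + κ) * (η * (H * ζ)) ^ 2 := fun m => by
    have a1 := norm_damped_step_sub_le hH (h1 m) (h2 m) hη.le (a := 1 - η * μ) (by linarith)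
      (by nlinarith) (by linarith) (x m) w
    have a2 : ‖η • (∇ (P.F m) w - ∇ (P.F m₀) w)‖ ≤ η * (H * ζ) := by
      rw [norm_smul, Real.norm_of_nonneg hη.le]
      gcongr
      exact h8 _ _ _
    have a3 : ‖P.drift η μ x m - ((1 - η * μ) • w - η • ∇ (P.F m₀) w)‖
        ≤ ‖x m - w‖ + η * (H * ζ) := by
      refine le_trans (le_of_eq ?_) ((norm_sub_le _ _).trans (add_le_add a1 a2))
      congr 1
      simp only [drift]
      module
    have a4 := pow_le_pow_left₀ (norm_nonneg _) a3 2
    refine a4.trans ?_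
    generalize η * (H * ζ) = b
    generalize ‖x m - w‖ = a
    have : (1 + 1 / κ) * a ^ 2 + (1 + κ) * b ^ 2 - (a + b) ^ 2 = (a - κ * b) ^ 2 / κ := by
      field_simp; ring
    have : 0 ≤ (a - κ * b) ^ 2 / κ := by positivity
    linarith
  refine (dispersion_le hM _ ((1 - η * μ) • w - η • ∇ (P.F m₀) w)).trans ?_
  refine (mul_le_mul_of_nonneg_left (Finset.sum_le_sum fun m _ => hb m) (by positivity)).trans_eq ?_
  have hM' : (M : ℝ) ≠ 0 := by positivity
  rw [dispersion, Finset.sum_add_distrib, ← Finset.mul_sum, ← hw]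
  simp
  field_simp

theorem famMean_drift (η μ : ℝ) (x : Fin M → Vec d) :
    famMean (P.drift η μ x)
      = famMean x - η • (P.avgGrad (famMean x) + μ • famMean x + P.gradBias x) := by
  set w := famMean x with hw
  change famMean (fun m => (1 - η * μ) • x m - η • ∇ (P.F m) (x m))
    = w - η • (famMean (fun m => ∇ (P.F m) w) + μ • w
      + famMean (fun m => ∇ (P.F m) (x m) - ∇ (P.F m) w))
  have : ∑ m, (1 - η * μ) • x m = (1 - η * μ) • ∑ m, x m := Finset.smul_sum.symm
  simp only [famMean, Finset.sum_sub_distrib, this, ← Finset.smul_sum]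
  rw [hw, famMean]
  module

/-- One noiseless step of the averaged iterate. -/
theorem norm_famMean_drift_sub_sq_le (hM : 0 < M) {H B η μ : ℝ} (hH : 0 < H)
    (h1 : P.Convex) (h2 : P.SecondOrderSmooth H)
    (hη : 0 < η) (hμ : 0 < μ) (hημ : η * μ ≤ 1 / 4) (hηH : 8 * (η * H) ≤ 1)
    {y : Vec d} (hy : y ∈ P.optima) (hyB : ‖y‖ ≤ B) (x : Fin M → Vec d) :
    ‖famMean (P.drift η μ x) - y‖ ^ 2 ≤ (1 - η * μ / 2) * ‖famMean x - y‖ ^ 2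
      - η * (P.avg (famMean x) - P.avg y) + η * μ * B ^ 2 + 3 * η / μ * ‖P.gradBias x‖ ^ 2 := by
  rw [famMean_drift]
  set w := famMean x
  set e := P.gradBias x
  set g := P.avgGrad w
  have c1 := h1.avg w y
  have c2 := norm_sq_le_of_smooth hH (h2.avg hM) hy w
  have hgap : 0 ≤ P.avg w - P.avg y := sub_nonneg.2 (hy w)
  set δ := P.avg w - P.avg y
  have e1 : w - η • (g + μ • w + e) - y = (w - y) - η • (g + μ • w + e) := by abel
  rw [e1, norm_sub_sq_real, real_inner_smul_right, norm_smul, mul_pow, Real.norm_eq_abs, sq_abs,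
    inner_add_right, inner_add_right, real_inner_smul_right]
  have c3 : inner ℝ (w - y) g ≥ δ := by
    rw [← neg_sub, inner_neg_left, real_inner_comm]
    simp only [δ]; linarith
  -- Times `-2 * η * μ`, this yields a contraction `η * μ`, a negative multiple of `‖w‖ ^ 2` that
  -- absorbs the second-order term in `d3`, and the price `η * μ * ‖y‖ ^ 2`.
  have c4 : inner ℝ (w - y) w = ‖w - y‖ ^ 2 / 2 + ‖w‖ ^ 2 / 2 - ‖y‖ ^ 2 / 2 := by
    have := norm_sub_sq_real (w - y) w
    rw [sub_sub_cancel_left, norm_neg] at this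
    linarith
  -- Half of the contraction is spent on the bias, leaving the factor `1 - η * μ / 2`.
  have c5 : -(2 * η * inner ℝ (w - y) e) ≤ η * μ / 2 * ‖w - y‖ ^ 2 + 2 * η / μ * ‖e‖ ^ 2 := by
    have h := neg_le_of_abs_le (abs_real_inner_le_norm (w - y) e)
    have h' : η * μ / 2 * ‖w - y‖ ^ 2 + 2 * η / μ * ‖e‖ ^ 2 - 2 * η * (‖w - y‖ * ‖e‖)
      = η / (2 * μ) * (μ * ‖w - y‖ - 2 * ‖e‖) ^ 2 := by field_simp; ring
    have h'' : 0 ≤ η / (2 * μ) * (μ * ‖w - y‖ - 2 * ‖e‖) ^ 2 := by positivity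
    nlinarith
  have c6 : ‖g + μ • w + e‖ ^ 2 ≤ 4 * ‖g‖ ^ 2 + 4 * μ ^ 2 * ‖w‖ ^ 2 + 2 * ‖e‖ ^ 2 := by
    have p1 := parallelogram_law_with_norm ℝ (g + μ • w) e
    have p2 := parallelogram_law_with_norm ℝ g (μ • w)
    have p3 : ‖μ • w‖ * ‖μ • w‖ = μ ^ 2 * ‖w‖ ^ 2 := by
      rw [norm_smul, Real.norm_of_nonneg hμ.le]; ring
    nlinarith [mul_self_nonneg ‖g + μ • w - e‖, mul_self_nonneg ‖g - μ • w‖]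
  have c7 : ‖y‖ ^ 2 ≤ B ^ 2 := pow_le_pow_left₀ (norm_nonneg _) hyB 2
  have d1 : η ^ 2 * ‖g + μ • w + e‖ ^ 2
      ≤ η ^ 2 * (4 * (2 * H * δ) + 4 * μ ^ 2 * ‖w‖ ^ 2 + 2 * ‖e‖ ^ 2) := by
    refine mul_le_mul_of_nonneg_left (c6.trans ?_) (sq_nonneg _)
    linarith
  have d2 : η * δ * (8 * (η * H)) ≤ η * δ * 1 := by gcongr
  have d3 : η * μ * ‖w‖ ^ 2 * (η * μ) ≤ η * μ * ‖w‖ ^ 2 * (1 / 4) := by gcongr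
  have d4 : 2 * η ^ 2 * ‖e‖ ^ 2 ≤ η / μ * ‖e‖ ^ 2 := by
    gcongr
    rw [le_div_iff₀ hμ]
    nlinarith
  have d5 : η * inner ℝ (w - y) g ≥ η * δ := by gcongr
  have d6 : η * μ * ‖y‖ ^ 2 ≤ η * μ * B ^ 2 := by gcongr
  have d7 : 3 * η / μ * ‖e‖ ^ 2 = 2 * η / μ * ‖e‖ ^ 2 + η / μ * ‖e‖ ^ 2 := by ring
  rw [d7, c4]
  linarith

end FedProblem

/-! ### Moments of one noisy step from a fixed state. -/

namespace FedProblem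

variable {d M : ℕ} {Z : Type*} [MeasurableSpace Z] {P : FedProblem d M Z}

instance (m : Fin M) : IsProbabilityMeasure (P.dist m) := P.isProb m

theorem measurable_noise (m : Fin M) (x : Vec d) : Measurable (P.noise m x) :=
  ((P.measurable_grad m).comp measurable_prodMk_left).sub_const _

theorem integrable_noise (m : Fin M) (x : Vec d) : Integrable (P.noise m x) (P.dist m) :=
  (P.integrable_grad m x).sub (integrable_const _)

theorem integral_noise (m : Fin M) (x : Vec d) : ∫ z, P.noise m x z ∂(P.dist m) = 0 := by
  unfold noise
  rw [integral_sub (P.integrable_grad m x) (integrable_const _), P.integral_grad]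
  simp

theorem integrable_inner_noise (m : Fin M) (x v : Vec d) :
    Integrable (fun z : Fin M → Z => inner ℝ v (P.noise m x (z m))) (Measure.pi P.dist) :=
  (integrable_comp_eval (μ := P.dist) (integrable_noise m x)).const_inner v

theorem integral_inner_noise (m : Fin M) (x v : Vec d) :
    ∫ z : Fin M → Z, inner ℝ v (P.noise m x (z m)) ∂(Measure.pi P.dist) = 0 := by
  rw [integral_inner (integrable_comp_eval (μ := P.dist) (integrable_noise m x)),
    integral_comp_eval (integrable_noise m x).1, integral_noise, inner_zero_right]

theorem integral_inner_noise_noise {m n : Fin M} (h : m ≠ n) (x y : Vec d) :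
    Integrable (fun z : Fin M → Z => inner ℝ (P.noise m x (z m)) (P.noise n y (z n)))
      (Measure.pi P.dist) ∧
    ∫ z : Fin M → Z, inner ℝ (P.noise m x (z m)) (P.noise n y (z n)) ∂(Measure.pi P.dist) = 0 := by
  have hind : IndepFun (fun z : Fin M → Z => P.noise m x (z m)) (fun z => P.noise n y (z n))
      (Measure.pi P.dist) :=
    (iIndepFun_pi (μ := P.dist) (X := fun _ => id) fun _ => aemeasurable_id).indepFun h |>.comp
      (measurable_noise m x) (measurable_noise n y)
  have hx := integrable_comp_eval (μ := P.dist) (integrable_noise m x)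
  have hy := integrable_comp_eval (μ := P.dist) (integrable_noise n y)
  refine ⟨hind.integrable_bilin hx hy (innerSL ℝ), (hind.integral_bilin hx hy (innerSL ℝ)).trans ?_⟩
  rw [integral_comp_eval (integrable_noise m x).1, integral_noise, map_zero, zero_apply]

/-- The noise of the local gradients at given points, as a function of the samples. -/
noncomputable def noises (P : FedProblem d M Z) (x : Fin M → Vec d) (z : Fin M → Z) (m : Fin M) :
    Vec d := P.noise m (x m) (z m)

theorem integral_mean_noise_pow_le {k : ℕ} {s : Fin M → ℝ} {σ : ℝ}
    (hσ : (1 / (M : ℝ)) * ∑ m, s m ^ k = σ ^ k)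
    (hs : ∀ m x, Integrable (fun z => ‖P.grad m x z - ∇ (P.F m) x‖ ^ k) (P.dist m) ∧
      ∫ z, ‖P.grad m x z - ∇ (P.F m) x‖ ^ k ∂(P.dist m) ≤ s m ^ k) (x : Fin M → Vec d) :
    Integrable (fun z => (1 / (M : ℝ)) * ∑ m, ‖P.noises x z m‖ ^ k) (Measure.pi P.dist) ∧
    ∫ z, (1 / (M : ℝ)) * ∑ m, ‖P.noises x z m‖ ^ k ∂(Measure.pi P.dist) ≤ σ ^ k := by
  have hi : ∀ m, Integrable (fun z : Fin M → Z => ‖P.noises x z m‖ ^ k) (Measure.pi P.dist) :=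
    fun m => integrable_comp_eval (μ := P.dist) (hs m (x m)).1
  refine ⟨(integrable_finsetSum _ fun m _ => hi m).const_mul _, ?_⟩
  rw [integral_const_mul, integral_finsetSum _ fun m _ => hi m, ← hσ]
  gcongr with m
  exact (integral_comp_eval (μ := P.dist) (hs m (x m)).1.1).trans_le (hs m (x m)).2

theorem integral_famCov_noises (u x : Fin M → Vec d) :
    Integrable (fun z => famCov u (P.noises x z)) (Measure.pi P.dist) ∧
    ∫ z, famCov u (P.noises x z) ∂(Measure.pi P.dist) = 0 := by
  have hi := fun m => integrable_inner_noise (P := P) m (x m) (u m - famMean u)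
  refine ⟨(integrable_finsetSum _ fun m _ => hi m).const_mul _, ?_⟩
  unfold famCov noises
  rw [integral_const_mul, integral_finsetSum _ fun m _ => hi m]
  simp [integral_inner_noise]

theorem integral_inner_famMean_noises (v : Vec d) (x : Fin M → Vec d) :
    Integrable (fun z => inner ℝ v (famMean (P.noises x z))) (Measure.pi P.dist) ∧
    ∫ z, inner ℝ v (famMean (P.noises x z)) ∂(Measure.pi P.dist) = 0 := by
  have hi := fun m => integrable_inner_noise (P := P) m (x m) v
  simp only [famMean, noises, real_inner_smul_right, inner_sum]
  refine ⟨(integrable_finsetSum _ fun m _ => hi m).const_mul _, ?_⟩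
  rw [integral_const_mul, integral_finsetSum _ fun m _ => hi m]
  simp [integral_inner_noise]

/-- Independence and centering kill the off-diagonal products, which yields the factor `1 / M`. -/
theorem integral_norm_famMean_noises_sq_le {s : Fin M → ℝ} {σ : ℝ}
    (hσ : (1 / (M : ℝ)) * ∑ m, s m ^ 2 = σ ^ 2)
    (hs : ∀ m x, Integrable (fun z => ‖P.grad m x z - ∇ (P.F m) x‖ ^ 2) (P.dist m) ∧
      ∫ z, ‖P.grad m x z - ∇ (P.F m) x‖ ^ 2 ∂(P.dist m) ≤ s m ^ 2) (x : Fin M → Vec d) :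
    Integrable (fun z => ‖famMean (P.noises x z)‖ ^ 2) (Measure.pi P.dist) ∧
    ∫ z, ‖famMean (P.noises x z)‖ ^ 2 ∂(Measure.pi P.dist) ≤ σ ^ 2 / M := by
  have e : ∀ z, ‖famMean (P.noises x z)‖ ^ 2
      = (1 / (M : ℝ)) ^ 2 * ∑ m, ∑ n, inner ℝ (P.noises x z m) (P.noises x z n) := fun z => by
    rw [famMean, norm_smul, mul_pow, ← real_inner_self_eq_norm_sq (∑ m, _), sum_inner]
    simp [inner_sum]
  have hi : ∀ m n, Integrable (fun z => inner ℝ (P.noises x z m) (P.noises x z n))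
      (Measure.pi P.dist) := fun m n => by
    by_cases h : m = n
    · subst h
      simp only [real_inner_self_eq_norm_sq]
      exact integrable_comp_eval (μ := P.dist) (hs m (x m)).1
    · exact (integral_inner_noise_noise h _ _).1
  have hi' : ∀ m, Integrable (fun z => ∑ n, inner ℝ (P.noises x z m) (P.noises x z n))
      (Measure.pi P.dist) := fun m => integrable_finsetSum _ fun n _ => hi m n
  simp only [e]
  refine ⟨(integrable_finsetSum _ fun m _ => hi' m).const_mul _, ?_⟩
  rw [integral_const_mul, integral_finsetSum _ fun m _ => hi' m]
  have key : ∀ m, ∫ z, ∑ n, inner ℝ (P.noises x z m) (P.noises x z n) ∂(Measure.pi P.dist)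
      ≤ s m ^ 2 := fun m => by
    have h0 : ∀ n ∈ Finset.univ, n ≠ m →
        ∫ z, inner ℝ (P.noises x z m) (P.noises x z n) ∂(Measure.pi P.dist) = 0 :=
      fun n _ hn => (integral_inner_noise_noise hn.symm (x m) (x n)).2
    rw [integral_finsetSum _ fun n _ => hi m n, Finset.sum_eq_single m h0 (by simp)]
    simp only [real_inner_self_eq_norm_sq]
    exact (integral_comp_eval (μ := P.dist) (hs m (x m)).1.1).trans_le (hs m (x m)).2
  rw [← hσ]
  calc _ ≤ (1 / (M : ℝ)) ^ 2 * ∑ m, s m ^ 2 := by gcongr with m; exact key m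
    _ = _ := by ring

theorem measurable_noises (x : Fin M → Vec d) : Measurable (P.noises x) :=
  measurable_pi_lambda _ fun m =>
    (measurable_noise m (x m)).comp (measurable_pi_apply m)

theorem continuous_famMean : Continuous (famMean : (Fin M → Vec d) → Vec d) := by
  unfold famMean; fun_prop

theorem continuous_dispersion : Continuous (dispersion : (Fin M → Vec d) → ℝ) := by
  have := continuous_famMean (d := d) (M := M)
  unfold dispersion; fun_prop

theorem localStep_eq (η μ : ℝ) (x : Fin M → Vec d) (z : Fin M → Z) :
    P.localStep η μ x z = fun m => P.drift η μ x m - η • P.noises x z m := rfl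

theorem measurable_localStep_right (η μ : ℝ) (x : Fin M → Vec d) :
    Measurable (P.localStep η μ x) :=
  measurable_pi_lambda _ fun m =>
    (((measurable_pi_apply m).comp (measurable_noises (P := P) x)).const_smul η).const_sub _

theorem integral_dispersion_localStep_le (hM : 0 < M) {σ₂ : ℝ} (h4 : P.BoundedSecondMoment σ₂)
    (η μ : ℝ) (x : Fin M → Vec d) :
    Integrable (fun z => dispersion (P.localStep η μ x z)) (Measure.pi P.dist) ∧
    ∫ z, dispersion (P.localStep η μ x z) ∂(Measure.pi P.dist)
      ≤ dispersion (P.drift η μ x) + η ^ 2 * σ₂ ^ 2 := by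
  obtain ⟨s, -, hσ, hs⟩ := h4
  obtain ⟨i1, b1⟩ := integral_mean_noise_pow_le hσ hs x
  obtain ⟨i2, b2⟩ := integral_famCov_noises (P := P) (P.drift η μ x) x
  have hle : ∀ z, dispersion (P.localStep η μ x z) ≤ dispersion (P.drift η μ x)
      - 2 * η * famCov (P.drift η μ x) (P.noises x z)
      + η ^ 2 * ((1 / (M : ℝ)) * ∑ m, ‖P.noises x z m‖ ^ 2) := fun z => by
    rw [localStep_eq, dispersion_sub_smul hM]
    gcongr
    exact dispersion_le_mean_norm_sq hM _
  have j1 : Integrable (fun z => dispersion (P.drift η μ x)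
      - 2 * η * famCov (P.drift η μ x) (P.noises x z)) (Measure.pi P.dist) :=
    (integrable_const _).sub (i2.const_mul (2 * η))
  have j2 := i1.const_mul (η ^ 2)
  have hint := (j1.add j2).mono'
    (continuous_dispersion.measurable.comp (measurable_localStep_right η μ x)).aestronglyMeasurable
    (.of_forall fun z => by
      rw [Function.comp_apply, Real.norm_of_nonneg (dispersion_nonneg _)]; exact hle z)
  refine ⟨hint, (integral_mono hint (j1.add j2) hle).trans ?_⟩
  simp only [Pi.add_apply]
  rw [integral_add j1 j2, integral_sub (integrable_const _) (i2.const_mul (2 * η)),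
    integral_const_mul, integral_const_mul, b2]
  simp only [integral_const, probReal_univ, one_smul, mul_zero, sub_zero]
  gcongr

/-- The cross term of size `10 * η ^ 2 * σ₂ ^ 2` is completed to a square, so that the bound on the
dispersion of the drift can be inserted inside it. -/
theorem integral_dispersion_localStep_sq_le (hM : 0 < M) {σ₂ σ₄ : ℝ}
    (h4 : P.BoundedSecondMoment σ₂) (h5 : P.BoundedFourthMoment σ₄)
    (η μ : ℝ) (x : Fin M → Vec d) :
    Integrable (fun z => dispersion (P.localStep η μ x z) ^ 2) (Measure.pi P.dist) ∧
    ∫ z, dispersion (P.localStep η μ x z) ^ 2 ∂(Measure.pi P.dist)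
      ≤ (dispersion (P.drift η μ x) + 5 * η ^ 2 * σ₂ ^ 2) ^ 2 + 2 * η ^ 4 * σ₄ ^ 4 := by
  obtain ⟨s, -, hσ, hs⟩ := h4
  obtain ⟨r, -, hr, hr'⟩ := h5
  obtain ⟨i1, b1⟩ := integral_mean_noise_pow_le hσ hs x
  obtain ⟨i3, b3⟩ := integral_mean_noise_pow_le hr hr' x
  obtain ⟨i2, b2⟩ := integral_famCov_noises (P := P) (P.drift η μ x) x
  set U := dispersion (P.drift η μ x)
  have hU : 0 ≤ U := dispersion_nonneg _
  have hle := fun z => dispersion_sub_smul_sq_le hM (P.drift η μ x) (P.noises x z) η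
  have j1 : Integrable (fun z => U ^ 2 - 4 * η * U * famCov (P.drift η μ x) (P.noises x z))
      (Measure.pi P.dist) := (integrable_const _).sub (i2.const_mul (4 * η * U))
  have j2 := i1.const_mul (10 * η ^ 2 * U)
  have j12 : Integrable (fun z => U ^ 2 - 4 * η * U * famCov (P.drift η μ x) (P.noises x z)
      + 10 * η ^ 2 * U * ((1 / (M : ℝ)) * ∑ m, ‖P.noises x z m‖ ^ 2)) (Measure.pi P.dist) :=
    j1.add j2
  have j3 := i3.const_mul (2 * η ^ 4)
  have hint := (j12.add j3).mono'
    ((continuous_dispersion.measurable.comp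
      (measurable_localStep_right η μ x)).pow_const 2).aestronglyMeasurable
    (.of_forall fun z => by
      rw [Function.comp_apply, Real.norm_of_nonneg (sq_nonneg _)]; exact hle z)
  refine ⟨hint, (integral_mono hint (j12.add j3) hle).trans ?_⟩
  simp only [Pi.add_apply]
  rw [integral_add j12 j3, integral_add j1 j2,
    integral_sub (integrable_const _) (i2.const_mul _), integral_const_mul (4 * η * U),
    integral_const_mul (10 * η ^ 2 * U), integral_const_mul (2 * η ^ 4), b2]
  simp only [integral_const, probReal_univ, one_smul, mul_zero, sub_zero]
  have c1 := mul_le_mul_of_nonneg_left b1 (show 0 ≤ 10 * η ^ 2 * U by positivity)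
  have c3 := mul_le_mul_of_nonneg_left b3 (show 0 ≤ 2 * η ^ 4 by positivity)
  nlinarith [sq_nonneg (5 * η ^ 2 * σ₂ ^ 2)]

theorem integral_norm_famMean_localStep_sub_sq_le {σ₂ : ℝ} (h4 : P.BoundedSecondMoment σ₂)
    (η μ : ℝ) (x : Fin M → Vec d) (y : Vec d) :
    Integrable (fun z => ‖famMean (P.localStep η μ x z) - y‖ ^ 2) (Measure.pi P.dist) ∧
    ∫ z, ‖famMean (P.localStep η μ x z) - y‖ ^ 2 ∂(Measure.pi P.dist)
      ≤ ‖famMean (P.drift η μ x) - y‖ ^ 2 + η ^ 2 * (σ₂ ^ 2 / M) := by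
  obtain ⟨s, -, hσ, hs⟩ := h4
  obtain ⟨i1, b1⟩ := integral_norm_famMean_noises_sq_le hσ hs x
  obtain ⟨i2, b2⟩ := integral_inner_famMean_noises (P := P) (famMean (P.drift η μ x) - y) x
  have e : ∀ z, ‖famMean (P.localStep η μ x z) - y‖ ^ 2 = ‖famMean (P.drift η μ x) - y‖ ^ 2
      - 2 * η * inner ℝ (famMean (P.drift η μ x) - y) (famMean (P.noises x z))
      + η ^ 2 * ‖famMean (P.noises x z)‖ ^ 2 := fun z => by
    rw [localStep_eq, famMean_sub_smul, sub_right_comm, norm_sub_sq_real, real_inner_smul_right,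
      norm_smul, mul_pow, Real.norm_eq_abs, sq_abs]
    ring
  have j1 : Integrable (fun z => ‖famMean (P.drift η μ x) - y‖ ^ 2
      - 2 * η * inner ℝ (famMean (P.drift η μ x) - y) (famMean (P.noises x z)))
      (Measure.pi P.dist) := (integrable_const _).sub (i2.const_mul (2 * η))
  have j2 := i1.const_mul (η ^ 2)
  simp only [e]
  refine ⟨j1.add j2, ?_⟩
  rw [integral_add j1 j2, integral_sub (integrable_const _) (i2.const_mul (2 * η)),
    integral_const_mul, integral_const_mul, b2]
  simp only [integral_const, probReal_univ, one_smul, mul_zero, sub_zero]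
  gcongr

end FedProblem

/-! ### From bounds at a fixed state to expectations along the trajectory. -/

/-- Fubini on the product law takes the place of conditional expectation; nonnegativity of `φ` lets
integrability follow from that of `ψ`. -/
theorem integral_comp_le_of_indepFun {Ω S T : Type*} [MeasurableSpace Ω] [MeasurableSpace S]
    [MeasurableSpace T] {ν : Measure Ω} [IsProbabilityMeasure ν] {X : Ω → S} {Y : Ω → T}
    (hX : Measurable X) (hY : Measurable Y) (h : IndepFun X Y ν) {φ : S × T → ℝ} {ψ : S → ℝ}
    (hφ : Measurable φ) (hφ0 : ∀ p, 0 ≤ φ p) (hψ : Measurable ψ)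
    (hφi : ∀ x, Integrable (fun y => φ (x, y)) (ν.map Y))
    (hle : ∀ x, ∫ y, φ (x, y) ∂(ν.map Y) ≤ ψ x) (hψi : Integrable (fun ω => ψ (X ω)) ν) :
    Integrable (fun ω => φ (X ω, Y ω)) ν ∧ ∫ ω, φ (X ω, Y ω) ∂ν ≤ ∫ ω, ψ (X ω) ∂ν := by
  have := Measure.isProbabilityMeasure_map hX.aemeasurable (μ := ν)
  have := Measure.isProbabilityMeasure_map hY.aemeasurable (μ := ν)
  have hmap := (indepFun_iff_map_prod_eq_prod_map_map hX.aemeasurable hY.aemeasurable).1 h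
  have hψi' : Integrable ψ (ν.map X) :=
    (integrable_map_measure hψ.aestronglyMeasurable hX.aemeasurable).2 hψi
  have hle' : ∀ x, ‖∫ y, ‖φ (x, y)‖ ∂(ν.map Y)‖ ≤ ψ x := fun x => by
    simp only [Real.norm_of_nonneg (hφ0 _)]
    rw [Real.norm_of_nonneg (integral_nonneg fun y => hφ0 _)]
    exact hle x
  have hint : Integrable φ ((ν.map X).prod (ν.map Y)) := by
    rw [integrable_prod_iff hφ.aestronglyMeasurable]
    refine ⟨.of_forall hφi, hψi'.mono' ?_ (.of_forall hle')⟩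
    exact hφ.norm.stronglyMeasurable.integral_prod_right'.aestronglyMeasurable
  have hint' : Integrable φ (ν.map fun ω => (X ω, Y ω)) := by rwa [hmap]
  refine ⟨(integrable_map_measure hφ.aestronglyMeasurable (hX.prodMk hY).aemeasurable).1 hint', ?_⟩
  rw [← integral_map (hX.prodMk hY).aemeasurable hφ.aestronglyMeasurable, hmap,
    integral_prod _ hint, ← integral_map hX.aemeasurable hψ.aestronglyMeasurable]
  exact integral_mono hint.integral_prod_left hψi' hle

section LocalSGD

variable {d M : ℕ} {Z : Type*}

theorem localSGD_congr (g : Fin M → Vec d → Z → Vec d) (η : ℝ) (K : ℕ) {z z' : ℕ → Fin M → Z}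
    {t : ℕ} (h : ∀ s < t, z s = z' s) : localSGD g η K z t = localSGD g η K z' t := by
  induction t with
  | zero => rfl
  | succ t ih =>
    funext m
    simp only [localSGD, ih fun s hs => h s (hs.trans t.lt_succ_self), h t t.lt_succ_self]

theorem measurable_localSGD [MeasurableSpace Z] {g : Fin M → Vec d → Z → Vec d}
    (hg : ∀ m, Measurable fun p : Vec d × Z => g m p.1 p.2) (η : ℝ) (K t : ℕ) :
    Measurable fun z : ℕ → Fin M → Z => localSGD g η K z t := by
  induction t with
  | zero => exact measurable_const
  | succ t ih =>
    have hx : ∀ m, Measurable fun z : ℕ → Fin M → Z => localSGD g η K z t m :=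
      fun m => (measurable_pi_apply m).comp ih
    have hz : ∀ m, Measurable fun z : ℕ → Fin M → Z => z t m :=
      fun m => (measurable_pi_apply m).comp (measurable_pi_apply t)
    have hs : ∀ m, Measurable fun z : ℕ → Fin M → Z =>
        localSGD g η K z t m - η • g m (localSGD g η K z t m) (z t m) := fun m =>
      (hx m).sub (((hg m).comp ((hx m).prodMk (hz m))).const_smul η)
    refine measurable_pi_lambda _ fun m => ?_
    simp only [localSGD]
    split_ifs
    · exact (Finset.measurable_sum _ fun n _ => hs n).const_smul (1 / (M : ℝ))
    · exact hs m

end LocalSGD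

namespace FedProblem

variable {d M : ℕ} {Z : Type*} [MeasurableSpace Z] {P : FedProblem d M Z}

theorem localStep_apply (η μ : ℝ) (x : Fin M → Vec d) (z : Fin M → Z) (m : Fin M) :
    P.localStep η μ x z m = x m - η • (P.regularize μ).grad m (x m) (z m) := by
  simp only [localStep, drift, noise, regularize]
  module

theorem measurable_localStep (η μ : ℝ) :
    Measurable fun p : (Fin M → Vec d) × (Fin M → Z) => P.localStep η μ p.1 p.2 := by
  refine measurable_pi_lambda _ fun m => ?_
  simp only [localStep_apply]
  have hx : Measurable fun p : (Fin M → Vec d) × (Fin M → Z) => p.1 m :=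
    (measurable_pi_apply m).comp measurable_fst
  have hz : Measurable fun p : (Fin M → Vec d) × (Fin M → Z) => p.2 m :=
    (measurable_pi_apply m).comp measurable_snd
  exact hx.sub ((((P.regularize μ).measurable_grad m).comp (hx.prodMk hz)).const_smul η)

theorem localSGD_regularize_succ (η μ : ℝ) (K : ℕ) (z : ℕ → Fin M → Z) (t : ℕ) :
    localSGD (P.regularize μ).grad η K z (t + 1) =
      if (t + 1) % K = 0 then
        fun _ => famMean (P.localStep η μ (localSGD (P.regularize μ).grad η K z t) (z t))
      else P.localStep η μ (localSGD (P.regularize μ).grad η K z t) (z t) := by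
  funext m
  split_ifs with h <;> simp only [localSGD, h, if_true, if_false, famMean, localStep_apply]

namespace IsSampling

variable {Ω : Type*} [MeasurableSpace Ω] {ν : Measure Ω} {z : ℕ → Fin M → Ω → Z}

theorem measurable_samples (hz : P.IsSampling ν z) (t : ℕ) : Measurable fun ω m => z t m ω :=
  measurable_pi_lambda _ fun m => hz.measurable t m

theorem measurable_iterate (hz : P.IsSampling ν z) {g : Fin M → Vec d → Z → Vec d}
    (hg : ∀ m, Measurable fun p : Vec d × Z => g m p.1 p.2) (η : ℝ) (K t : ℕ) :
    Measurable fun ω => localSGD g η K (fun t m => z t m ω) t :=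
  (measurable_localSGD hg η K t).comp (measurable_pi_lambda _ fun s => hz.measurable_samples s)

variable [IsProbabilityMeasure ν]

theorem map_eq_pi (hz : P.IsSampling ν z) (t : ℕ) :
    ν.map (fun ω m => z t m ω) = Measure.pi P.dist := by
  have h : iIndepFun (fun m => z t m) ν :=
    hz.indep.precomp (g := fun m : Fin M => (t, m)) fun a b hab => (Prod.ext_iff.1 hab).2
  rw [(iIndepFun_iff_map_fun_eq_pi_map fun m => (hz.measurable t m).aemeasurable).1 h]
  simp only [hz.law]

theorem indepFun_iterate (hz : P.IsSampling ν z) {g : Fin M → Vec d → Z → Vec d}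
    (hg : ∀ m, Measurable fun p : Vec d × Z => g m p.1 p.2) (η : ℝ) (K t : ℕ) :
    IndepFun (fun ω => localSGD g η K (fun t m => z t m ω) t) (fun ω m => z t m ω) ν := by
  classical
  obtain ⟨ω₀⟩ : Nonempty Ω := nonempty_of_isProbabilityMeasure ν
  let S : Finset (ℕ × Fin M) := Finset.range t ×ˢ Finset.univ
  let T : Finset (ℕ × Fin M) := {t} ×ˢ Finset.univ
  have hST : Disjoint S T := by
    rw [Finset.disjoint_left]
    intro p hp hp'
    simp only [S, T, Finset.mem_product, Finset.mem_range, Finset.mem_singleton] at hp hp'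
    omega
  -- The iterate ignores samples from time `t` on, so these are frozen at `ω₀`; it then factors
  -- through finitely many coordinates, disjoint from those of time `t`.
  let Φ : (S → Z) → ℕ → Fin M → Z := fun f s m =>
    if h : (s, m) ∈ S then f ⟨(s, m), h⟩ else z s m ω₀
  have hΦ : Measurable Φ := by
    refine measurable_pi_lambda _ fun s => measurable_pi_lambda _ fun m => ?_
    by_cases h : (s, m) ∈ S
    · simpa only [Φ, h, dif_pos] using measurable_pi_apply _
    · simpa only [Φ, h, dif_neg, not_false_iff] using measurable_const
  let Ψ : (T → Z) → Fin M → Z := fun f m => f ⟨(t, m), by simp [T]⟩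
  have hΨ : Measurable Ψ := measurable_pi_lambda _ fun m => measurable_pi_apply _
  have h := (hz.indep.indepFun_finset S T hST fun p => hz.measurable p.1 p.2).comp
    ((measurable_localSGD hg η K t).comp hΦ) hΨ
  refine h.congr (.of_forall fun ω => ?_) (.of_forall fun ω => rfl)
  refine localSGD_congr g η K fun s hs => funext fun m => ?_
  have : (s, m) ∈ S := by simpa [S] using hs
  simp only [Φ, this, dif_pos]

/-- One step of Local SGD: a bound on the conditional expectation gives a bound on the
expectation. -/
theorem integral_localStep_le (hz : P.IsSampling ν z) (η μ : ℝ) (K t : ℕ)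
    {φ ψ : (Fin M → Vec d) → ℝ} (hφ : Measurable φ) (hφ0 : ∀ x, 0 ≤ φ x) (hψ : Measurable ψ)
    (hle : ∀ x, Integrable (fun y => φ (P.localStep η μ x y)) (Measure.pi P.dist) ∧
      ∫ y, φ (P.localStep η μ x y) ∂(Measure.pi P.dist) ≤ ψ x)
    (hψi : Integrable
      (fun ω => ψ (localSGD (P.regularize μ).grad η K (fun t m => z t m ω) t)) ν) :
    Integrable (fun ω => φ (P.localStep η μ
      (localSGD (P.regularize μ).grad η K (fun t m => z t m ω) t) (fun m => z t m ω))) ν ∧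
    ∫ ω, φ (P.localStep η μ
      (localSGD (P.regularize μ).grad η K (fun t m => z t m ω) t) (fun m => z t m ω)) ∂ν
      ≤ ∫ ω, ψ (localSGD (P.regularize μ).grad η K (fun t m => z t m ω) t) ∂ν := by
  have hg := (P.regularize μ).measurable_grad
  refine integral_comp_le_of_indepFun (hz.measurable_iterate hg η K t) (hz.measurable_samples t)
    (hz.indepFun_iterate hg η K t) (φ := fun p => φ (P.localStep η μ p.1 p.2))
    (hφ.comp (measurable_localStep η μ)) (fun _ => hφ0 _) hψ ?_ ?_ hψi
  · rw [hz.map_eq_pi]; exact fun x => (hle x).1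
  · rw [hz.map_eq_pi]; exact fun x => (hle x).2

/-- Growth between communications of a quantity that vanishes on consensus. -/
theorem integral_consensus_le (hz : P.IsSampling ν z) (η μ : ℝ) (K : ℕ)
    {φ : (Fin M → Vec d) → ℝ} (hφ : Measurable φ) (hφ0 : ∀ x, 0 ≤ φ x)
    (hφc : ∀ c, φ (fun _ => c) = 0) {r p : ℝ} (hr : 1 ≤ r) (hp : 0 ≤ p)
    (hle : ∀ x, Integrable (fun y => φ (P.localStep η μ x y)) (Measure.pi P.dist) ∧
      ∫ y, φ (P.localStep η μ x y) ∂(Measure.pi P.dist) ≤ r * φ x + p) (t : ℕ) :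
    Integrable (fun ω => φ (localSGD (P.regularize μ).grad η K (fun t m => z t m ω) t)) ν ∧
    ∫ ω, φ (localSGD (P.regularize μ).grad η K (fun t m => z t m ω) t) ∂ν
      ≤ (t % K : ℕ) * (r ^ (t % K) * p) := by
  induction t with
  | zero =>
    have : ∀ ω, φ (localSGD (P.regularize μ).grad η K (fun t m => z t m ω) 0) = 0 := fun ω => hφc 0
    simp [this]
  | succ t ih =>
    by_cases h : (t + 1) % K = 0
    · simp [localSGD_regularize_succ, h, hφc]
    · simp only [localSGD_regularize_succ, h, if_false]
      obtain ⟨i1, b1⟩ := hz.integral_localStep_le η μ K t hφ hφ0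
        ((hφ.const_mul r).add_const p) hle ((ih.1.const_mul r).add (integrable_const p))
      refine ⟨i1, b1.trans ?_⟩
      rw [integral_add (ih.1.const_mul r) (integrable_const p), integral_const_mul]
      have hmod : (t + 1) % K = t % K + 1 := by
        rcases Nat.eq_zero_or_pos K with rfl | hK
        · simp
        · have h1 : t % K + 1 ≤ K := Nat.mod_lt t hK
          rw [← Nat.mod_add_mod] at h ⊢
          exact Nat.mod_eq_of_lt (lt_of_le_of_ne h1 fun h2 => h (by rw [h2, Nat.mod_self]))
      rw [hmod]
      -- With `j = t % K`, the induction closes since `r * (j * r ^ j * p) + p ≤ (j + 1) * r ^ (j +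
      -- 1) * p` for `r ≥ 1`.
      have h2 : 1 ≤ r ^ (t % K + 1) := one_le_pow₀ hr
      have h3 := mul_le_mul_of_nonneg_left ih.2 (zero_le_one.trans hr)
      have h4 : 1 * p ≤ r ^ (t % K + 1) * p := by gcongr
      simp only [integral_const, probReal_univ, one_smul]
      push_cast
      rw [pow_succ] at h4 ⊢
      linarith

end IsSampling

end FedProblem

/-! ### Growth over a round and geometrically weighted sums. -/

theorem one_add_inv_pow_le_three {K k : ℕ} (hK : 0 < K) (hk : k ≤ K) :
    (1 + 1 / (K : ℝ)) ^ k ≤ 3 := by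
  have h1 : (1 : ℝ) ≤ 1 + 1 / (K : ℝ) := by
    have : 0 ≤ 1 / (K : ℝ) := by positivity
    linarith
  calc (1 + 1 / (K : ℝ)) ^ k ≤ (1 + 1 / (K : ℝ)) ^ K := pow_le_pow_right₀ h1 hk
    _ ≤ (Real.exp (1 / (K : ℝ))) ^ K := by
        gcongr
        rw [add_comm]
        exact Real.add_one_le_exp _
    _ = Real.exp 1 := by
        rw [← Real.exp_nat_mul]
        congr 1
        field_simp
    _ ≤ 3 := Real.exp_one_lt_three.le

section WeightedSum

theorem weighted_sum_succ (r : ℝ) (f : ℕ → ℝ) (n : ℕ) :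
    ∑ t ∈ Finset.range (n + 1), r ^ (n + 1 - 1 - t) * f t
      = r * ∑ t ∈ Finset.range n, r ^ (n - 1 - t) * f t + f n := by
  rw [Finset.sum_range_succ, Finset.mul_sum]
  congr 1
  · refine Finset.sum_congr rfl fun t ht => ?_
    have ht := Finset.mem_range.1 ht
    rw [← mul_assoc, ← pow_succ']
    congr 2
    omega
  · simp

theorem weighted_sum_le_of_contraction {D δ : ℕ → ℝ} {r η c : ℝ} (hr : 0 ≤ r)
    (h : ∀ t, D (t + 1) ≤ r * D t - η * δ t + c) (n : ℕ) :
    η * ∑ t ∈ Finset.range n, r ^ (n - 1 - t) * δ t + D n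
      ≤ r ^ n * D 0 + c * ∑ t ∈ Finset.range n, r ^ (n - 1 - t) := by
  induction n with
  | zero => simp
  | succ n ih =>
    have e := weighted_sum_succ r (fun _ => 1) n
    simp only [mul_one] at e
    rw [weighted_sum_succ, e, pow_succ']
    nlinarith [h n, mul_le_mul_of_nonneg_left ih hr]

theorem mul_pow_le_weight_sum {r : ℝ} (hr : 0 ≤ r) (hr1 : r ≤ 1) (n : ℕ) :
    n * r ^ n ≤ ∑ t ∈ Finset.range n, r ^ (n - 1 - t) := by
  have : ∑ _t ∈ Finset.range n, r ^ n ≤ ∑ t ∈ Finset.range n, r ^ (n - 1 - t) :=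
    Finset.sum_le_sum fun t _ => pow_le_pow_of_le_one hr hr1 (by omega)
  simpa using this

/-- The weights telescope the recursion. Each weight is at least `r ^ n`, so the initial term `r ^ n
* D 0` costs at most `D 0 / n` after normalization, whatever `r` is. -/
theorem weighted_average_le_of_contraction {D δ : ℕ → ℝ} {r η c : ℝ} (hr : 0 < r) (hr1 : r ≤ 1)
    (hη : 0 < η) (hD : ∀ t, 0 ≤ D t) (h : ∀ t, D (t + 1) ≤ r * D t - η * δ t + c) {n : ℕ}
    (hn : 0 < n) :
    (1 / ∑ t ∈ Finset.range n, r ^ (n - 1 - t)) * ∑ t ∈ Finset.range n, r ^ (n - 1 - t) * δ t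
      ≤ D 0 / (η * n) + c / η := by
  have h1 := weighted_sum_le_of_contraction hr.le h n
  have h2 := mul_pow_le_weight_sum hr.le hr1 n
  have hn' : (0 : ℝ) < n := by exact_mod_cast hn
  set W := ∑ t ∈ Finset.range n, r ^ (n - 1 - t)
  set S := ∑ t ∈ Finset.range n, r ^ (n - 1 - t) * δ t
  have hW : 0 < W := lt_of_lt_of_le (by positivity) h2
  have h3 : r ^ n ≤ W / n := by rw [le_div_iff₀ hn']; linarith
  have h4 : r ^ n * D 0 ≤ W / n * D 0 := mul_le_mul_of_nonneg_right h3 (hD 0)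
  have h5 : η * S ≤ W / n * D 0 + c * W := by linarith [hD n]
  rw [one_div, inv_mul_le_iff₀ hW, ← mul_le_mul_iff_right₀ hη]
  refine h5.trans_eq ?_
  field_simp

end WeightedSum

/-! ### Dispersion and error of Local SGD in expectation. -/

namespace FedProblem

variable {d M : ℕ} {Z : Type*} [MeasurableSpace Z] {P : FedProblem d M Z}

/-- Jensen's inequality from the tangent at the weighted mean, whose linear part averages to zero.
-/
theorem Convex.avg_weighted_le (h : P.Convex) {ι : Type*} (s : Finset ι) {w : ι → ℝ}
    (hw : ∀ i ∈ s, 0 ≤ w i) (hW : 0 < ∑ i ∈ s, w i) (x : ι → Vec d) (b : ℝ) :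
    P.avg ((1 / ∑ i ∈ s, w i) • ∑ i ∈ s, w i • x i) - b
      ≤ (1 / ∑ i ∈ s, w i) * ∑ i ∈ s, w i * (P.avg (x i) - b) := by
  set W := ∑ i ∈ s, w i with hWdef
  set c := (1 / W) • ∑ i ∈ s, w i • x i with hc
  have h1 : ∑ i ∈ s, w i * (P.avg c - b + inner ℝ (P.avgGrad c) (x i - c))
      ≤ ∑ i ∈ s, w i * (P.avg (x i) - b) :=
    Finset.sum_le_sum fun i hi => mul_le_mul_of_nonneg_left (by linarith [h.avg c (x i)]) (hw i hi)
  have h2 : ∑ i ∈ s, w i • (x i - c) = 0 := by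
    have : ∑ i ∈ s, w i • x i = W • c := by
      rw [hc, smul_smul, mul_one_div_cancel hW.ne', one_smul]
    simp only [smul_sub, Finset.sum_sub_distrib, ← Finset.sum_smul, this, ← hWdef, sub_self]
  have h3 : ∑ i ∈ s, w i * inner ℝ (P.avgGrad c) (x i - c) = 0 := by
    simp only [← real_inner_smul_right, ← inner_sum, h2, inner_zero_right]
  simp only [mul_add, Finset.sum_add_distrib, h3, ← Finset.sum_mul, add_zero, ← hWdef] at h1
  rw [one_div, le_inv_mul_iff₀ hW]
  exact h1

theorem continuous_avg (P : FedProblem d M Z) : Continuous P.avg := by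
  have := fun m => (P.differentiable m).continuous
  unfold avg
  fun_prop

/-- The gradient vanishes at a minimizer. This makes the objective gap integrable once the squared
distance is. -/
theorem SecondOrderSmooth.avg_sub_le {H : ℝ} (hM : 0 < M) (hH : 0 < H)
    (h : P.SecondOrderSmooth H) {y : Vec d} (hy : y ∈ P.optima) (x : Vec d) :
    P.avg x - P.avg y ≤ H / 2 * ‖x - y‖ ^ 2 := by
  have h0 := norm_sq_le_of_smooth hH (h.avg hM) hy y
  have h1 : P.avgGrad y = 0 := by
    rw [sub_self, mul_zero] at h0
    exact norm_eq_zero.1 (pow_eq_zero_iff two_ne_zero |>.1 (le_antisymm h0 (sq_nonneg _)))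
  have h2 := h.avg hM y x
  rw [h1, inner_zero_left, norm_sub_rev] at h2
  linarith

namespace IsSampling

variable {Ω : Type*} [MeasurableSpace Ω] {ν : Measure Ω} [IsProbabilityMeasure ν]
  {z : ℕ → Fin M → Ω → Z}

theorem integral_dispersion_le (hz : P.IsSampling ν z) (hM : 0 < M) {H ζ σ₂ η μ : ℝ} {K : ℕ}
    (hK : 0 < K) (hH : 0 < H) (h1 : P.Convex) (h2 : P.SecondOrderSmooth H)
    (h4 : P.BoundedSecondMoment σ₂) (h8 : P.UniformFirstOrderHeterogeneity H ζ)
    (hη : 0 < η) (hμ : 0 < μ) (hημ : η * μ ≤ 1 / 2) (hηH : η * H ≤ 1) (t : ℕ) :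
    Integrable (fun ω => dispersion (localSGD (P.regularize μ).grad η K (fun t m => z t m ω) t)) ν ∧
    ∫ ω, dispersion (localSGD (P.regularize μ).grad η K (fun t m => z t m ω) t) ∂ν
      ≤ 3 * K * (2 * K * (η * (H * ζ)) ^ 2 + η ^ 2 * σ₂ ^ 2) := by
  have hK1 : (1 : ℝ) ≤ K := by exact_mod_cast hK
  have hr : (1 : ℝ) ≤ 1 + 1 / (K : ℝ) := by
    have : 0 ≤ 1 / (K : ℝ) := by positivity
    linarith
  have hle : ∀ x, Integrable (fun y => dispersion (P.localStep η μ x y)) (Measure.pi P.dist) ∧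
      ∫ y, dispersion (P.localStep η μ x y) ∂(Measure.pi P.dist) ≤ (1 + 1 / (K : ℝ)) * dispersion x
        + (2 * K * (η * (H * ζ)) ^ 2 + η ^ 2 * σ₂ ^ 2) := fun x => by
    obtain ⟨i, b⟩ := integral_dispersion_localStep_le hM h4 η μ x
    have c := dispersion_drift_le hM hH h1 h2 h8 hη hμ hημ hηH (κ := K) (by positivity) x
    refine ⟨i, b.trans ?_⟩
    have : (1 + (K : ℝ)) * (η * (H * ζ)) ^ 2 ≤ 2 * K * (η * (H * ζ)) ^ 2 := by
      gcongr; linarith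
    linarith
  obtain ⟨i, b⟩ := hz.integral_consensus_le η μ K (φ := dispersion) (r := 1 + 1 / K)
    (p := 2 * K * (η * (H * ζ)) ^ 2 + η ^ 2 * σ₂ ^ 2)
    continuous_dispersion.measurable dispersion_nonneg (dispersion_const hM) hr (by positivity)
    hle t
  have hmod : t % K ≤ K := (Nat.mod_lt t hK).le
  have h3 := one_add_inv_pow_le_three hK hmod
  refine ⟨i, b.trans ?_⟩
  calc _ ≤ (K : ℝ) * (3 * (2 * K * (η * (H * ζ)) ^ 2 + η ^ 2 * σ₂ ^ 2)) := by gcongr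
    _ = _ := by ring

theorem integral_dispersion_sq_le (hz : P.IsSampling ν z) (hM : 0 < M) {H ζ σ₂ σ₄ η μ : ℝ} {K : ℕ}
    (hK : 0 < K) (hH : 0 < H) (h1 : P.Convex) (h2 : P.SecondOrderSmooth H)
    (h4 : P.BoundedSecondMoment σ₂) (h5 : P.BoundedFourthMoment σ₄)
    (h8 : P.UniformFirstOrderHeterogeneity H ζ)
    (hη : 0 < η) (hμ : 0 < μ) (hημ : η * μ ≤ 1 / 2) (hηH : η * H ≤ 1) (t : ℕ) :
    Integrable
      (fun ω => dispersion (localSGD (P.regularize μ).grad η K (fun t m => z t m ω) t) ^ 2) ν ∧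
    ∫ ω, dispersion (localSGD (P.regularize μ).grad η K (fun t m => z t m ω) t) ^ 2 ∂ν
      ≤ 27 * K * (2 * K * (2 * K * (η * (H * ζ)) ^ 2 + 5 * η ^ 2 * σ₂ ^ 2) ^ 2
        + 2 * η ^ 4 * σ₄ ^ 4) := by
  have hK1 : (1 : ℝ) ≤ K := by exact_mod_cast hK
  have hr : (1 : ℝ) ≤ 1 + 1 / (K : ℝ) := by
    have : 0 ≤ 1 / (K : ℝ) := by positivity
    linarith
  have hle : ∀ x, Integrable (fun y => dispersion (P.localStep η μ x y) ^ 2) (Measure.pi P.dist) ∧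
      ∫ y, dispersion (P.localStep η μ x y) ^ 2 ∂(Measure.pi P.dist)
        ≤ (1 + 1 / (K : ℝ)) ^ 3 * dispersion x ^ 2 + (2 * K * (2 * K * (η * (H * ζ)) ^ 2 + 5 * η ^ 2 * σ₂ ^ 2) ^ 2
          + 2 * η ^ 4 * σ₄ ^ 4) := fun x => by
    obtain ⟨i, b⟩ := integral_dispersion_localStep_sq_le hM h4 h5 η μ x
    have c := dispersion_drift_le hM hH h1 h2 h8 hη hμ hημ hηH (κ := K) (by positivity) x
    refine ⟨i, b.trans ?_⟩
    have h0 := dispersion_nonneg (P.drift η μ x)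
    have hx := dispersion_nonneg x
    have e1 : (1 + (K : ℝ)) * (η * (H * ζ)) ^ 2 ≤ 2 * K * (η * (H * ζ)) ^ 2 := by
      gcongr; linarith
    set q := 2 * K * (η * (H * ζ)) ^ 2 + 5 * η ^ 2 * σ₂ ^ 2 with hq
    have e2 : (dispersion (P.drift η μ x) + 5 * η ^ 2 * σ₂ ^ 2) ^ 2
        ≤ ((1 + 1 / K) * dispersion x + q) ^ 2 := by
      refine pow_le_pow_left₀ (by positivity) ?_ 2
      linarith
    -- Young's inequality with weight `K` again; together with the squared drift factor it gives `(1
    -- + 1 / K) ^ 3` per step, hence at most `3 ^ 3 = 27` over a round.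
    have e3 : (1 + 1 / (K : ℝ)) * ((1 + 1 / K) * dispersion x) ^ 2 + (1 + K) * q ^ 2
        - ((1 + 1 / K) * dispersion x + q) ^ 2
        = ((1 + 1 / K) * dispersion x - K * q) ^ 2 / K := by
      field_simp; ring
    have e4 : 0 ≤ ((1 + 1 / (K : ℝ)) * dispersion x - K * q) ^ 2 / K := by positivity
    have e5 : (1 + (K : ℝ)) * q ^ 2 ≤ 2 * K * q ^ 2 := by gcongr; linarith
    have e6 : (1 + 1 / (K : ℝ)) ^ 3 * dispersion x ^ 2
        = (1 + 1 / (K : ℝ)) * ((1 + 1 / K) * dispersion x) ^ 2 := by ring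
    rw [e6]
    linarith
  obtain ⟨i, b⟩ := hz.integral_consensus_le η μ K (φ := fun x => dispersion x ^ 2)
    (r := (1 + 1 / K) ^ 3)
    (p := 2 * K * (2 * K * (η * (H * ζ)) ^ 2 + 5 * η ^ 2 * σ₂ ^ 2) ^ 2 + 2 * η ^ 4 * σ₄ ^ 4)
    (continuous_dispersion.measurable.pow_const 2) (fun x => sq_nonneg _)
    (fun c => by simp [dispersion_const hM]) (one_le_pow₀ hr) (by positivity) hle t
  have hmod : t % K ≤ K := (Nat.mod_lt t hK).le
  have h3 : ((1 + 1 / (K : ℝ)) ^ 3) ^ (t % K) ≤ 27 := by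
    rw [← pow_mul, mul_comm, pow_mul]
    calc _ ≤ (3 : ℝ) ^ 3 := by gcongr; exact one_add_inv_pow_le_three hK hmod
      _ = 27 := by norm_num
  refine ⟨i, b.trans ?_⟩
  calc _ ≤ (K : ℝ) * (27 * (2 * K * (2 * K * (η * (H * ζ)) ^ 2 + 5 * η ^ 2 * σ₂ ^ 2) ^ 2
      + 2 * η ^ 4 * σ₄ ^ 4)) := by gcongr
    _ = _ := by ring

/-- One step of the distance to a minimizer. -/
theorem integral_norm_sub_sq_succ_le (hz : P.IsSampling ν z) (hM : 0 < M)
    {H B Q τ ζ σ₂ σ₄ η μ e₂ e₄ : ℝ} {K : ℕ} (hK : 0 < K) (hH : 0 < H) (hQ : 0 ≤ Q)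
    (h1 : P.Convex) (h2 : P.SecondOrderSmooth H) (h3 : P.ThirdOrderSmooth Q)
    (h4 : P.BoundedSecondMoment σ₂) (h5 : P.BoundedFourthMoment σ₄)
    (h7 : P.SecondOrderHeterogeneity τ) (h8 : P.UniformFirstOrderHeterogeneity H ζ)
    (hη : 0 < η) (hμ : 0 < μ) (hημ : η * μ ≤ 1 / 4) (hηH : 8 * (η * H) ≤ 1)
    {y : Vec d} (hy : y ∈ P.optima) (hyB : ‖y‖ ≤ B)
    (he₂ : 3 * K * (2 * K * (η * (H * ζ)) ^ 2 + η ^ 2 * σ₂ ^ 2) ≤ e₂)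
    (he₄ : 27 * K * (2 * K * (2 * K * (η * (H * ζ)) ^ 2 + 5 * η ^ 2 * σ₂ ^ 2) ^ 2
        + 2 * η ^ 4 * σ₄ ^ 4) ≤ e₄)
    (X : ℕ → Ω → Fin M → Vec d)
    (hX : ∀ t ω, X t ω = localSGD (P.regularize μ).grad η K (fun t m => z t m ω) t) (t : ℕ)
    (hD : Integrable (fun ω => ‖famMean (X t ω) - y‖ ^ 2) ν) :
    Integrable (fun ω => P.avg (famMean (X t ω)) - P.avg y) ν ∧
    Integrable (fun ω => ‖famMean (X (t + 1) ω) - y‖ ^ 2) ν ∧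
    ∫ ω, ‖famMean (X (t + 1) ω) - y‖ ^ 2 ∂ν
      ≤ (1 - η * μ / 2) * ∫ ω, ‖famMean (X t ω) - y‖ ^ 2 ∂ν
        - η * ∫ ω, P.avg (famMean (X t ω)) - P.avg y ∂ν
        + (η * μ * B ^ 2 + 3 * η / μ * (2 * τ ^ 2 * e₂ + 2 * Q ^ 2 * e₄)
          + η ^ 2 * (σ₂ ^ 2 / M)) := by
  obtain ⟨i2, b2⟩ := hz.integral_dispersion_le hM hK hH h1 h2 h4 h8 hη hμ (by linarith)
    (by linarith) t
  obtain ⟨i4, b4⟩ := hz.integral_dispersion_sq_le hM hK hH h1 h2 h4 h5 h8 hη hμ (by linarith)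
    (by linarith) t
  simp only [← hX] at i2 b2 i4 b4
  have hXm : Measurable (X t) := by
    rw [show X t = _ from funext (hX t)]
    exact hz.measurable_iterate (P.regularize μ).measurable_grad η K t
  have hmean : Measurable (famMean : (Fin M → Vec d) → Vec d) := continuous_famMean.measurable
  have hδm : Measurable fun x : Fin M → Vec d => P.avg (famMean x) - P.avg y :=
    (P.continuous_avg.measurable.comp hmean).sub_const _
  have hδ : Integrable (fun ω => P.avg (famMean (X t ω)) - P.avg y) ν := by
    refine (hD.const_mul (H / 2)).mono' (hδm.comp hXm).aestronglyMeasurable (.of_forall fun ω => ?_)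
    rw [Real.norm_of_nonneg (sub_nonneg.2 (hy _))]
    exact h2.avg_sub_le hM hH hy _
  -- Communication preserves the mean, so the averaged iterate obeys the same recursion at every
  -- step.
  have hnext : ∀ ω, famMean (X (t + 1) ω)
      = famMean (P.localStep η μ (X t ω) (fun m => z t m ω)) := fun ω => by
    rw [hX, localSGD_regularize_succ, ← hX]
    split_ifs
    · exact famMean_const hM _
    · rfl
  have hDm : Measurable fun x : Fin M → Vec d => ‖famMean x - y‖ ^ 2 :=
    ((hmean.sub_const y).norm).pow_const 2
  have hdm : Measurable fun x : Fin M → Vec d => 2 * τ ^ 2 * dispersion x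
      + 2 * Q ^ 2 * dispersion x ^ 2 :=
    (continuous_dispersion.measurable.const_mul _).add
      ((continuous_dispersion.measurable.pow_const 2).const_mul _)
  set c := η * μ * B ^ 2 + η ^ 2 * (σ₂ ^ 2 / M) with hc
  have hd := ((i2.const_mul (2 * τ ^ 2)).add (i4.const_mul (2 * Q ^ 2)))
  have j1 := hD.const_mul (1 - η * μ / 2)
  have j2 := hδ.const_mul η
  have j3 := hd.const_mul (3 * η / μ)
  have j12 := j1.sub j2
  have j123 := j12.add j3
  obtain ⟨i, b⟩ := hz.integral_localStep_le η μ K t (φ := fun x => ‖famMean x - y‖ ^ 2)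
    (ψ := fun x => (1 - η * μ / 2) * ‖famMean x - y‖ ^ 2 - η * (P.avg (famMean x) - P.avg y)
      + 3 * η / μ * (2 * τ ^ 2 * dispersion x + 2 * Q ^ 2 * dispersion x ^ 2) + c)
    hDm (fun x => sq_nonneg _)
    ((((hDm.const_mul _).sub (hδm.const_mul _)).add (hdm.const_mul _)).add_const _)
    (fun x => by
      obtain ⟨i, b⟩ := integral_norm_famMean_localStep_sub_sq_le h4 η μ x y
      refine ⟨i, b.trans ?_⟩
      have a1 := norm_famMean_drift_sub_sq_le hM hH h1 h2 hη hμ hημ hηH hy hyB x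
      have a2 := mul_le_mul_of_nonneg_left (norm_gradBias_sq_le hM hQ h3 h7 x)
        (show 0 ≤ 3 * η / μ by positivity)
      linarith)
    (by simp only [← hX]; exact j123.add (integrable_const c))
  simp only [← hX] at i b
  simp only [hnext]
  refine ⟨hδ, i, b.trans ?_⟩
  have b2' : 2 * τ ^ 2 * ∫ ω, dispersion (X t ω) ∂ν ≤ 2 * τ ^ 2 * e₂ := by
    gcongr; exact b2.trans he₂
  have b4' : 2 * Q ^ 2 * ∫ ω, dispersion (X t ω) ^ 2 ∂ν ≤ 2 * Q ^ 2 * e₄ := by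
    gcongr; exact b4.trans he₄
  have b3 := mul_le_mul_of_nonneg_left (add_le_add b2' b4') (show 0 ≤ 3 * η / μ by positivity)
  refine (integral_add j123 (integrable_const c)).trans_le ?_
  rw [integral_add' j12 j3, integral_sub' j1 j2, integral_const_mul, integral_const_mul,
    integral_const_mul, integral_add' (i2.const_mul _) (i4.const_mul _), integral_const_mul,
    integral_const_mul]
  simp only [integral_const, probReal_univ, one_smul]
  linarith

/-- The error of the weighted iterate of Local SGD on the regularized problem. -/
theorem integral_avg_weightedIterate_sub_le (hz : P.IsSampling ν z) (hM : 0 < M)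
    {H B Q τ ζ σ₂ σ₄ η μ e₂ e₄ : ℝ} {K R : ℕ} (hK : 0 < K) (hR : 0 < R) (hH : 0 < H) (hQ : 0 ≤ Q)
    (h1 : P.Convex) (h2 : P.SecondOrderSmooth H) (h3 : P.ThirdOrderSmooth Q)
    (h4 : P.BoundedSecondMoment σ₂) (h5 : P.BoundedFourthMoment σ₄)
    (h7 : P.SecondOrderHeterogeneity τ) (h8 : P.UniformFirstOrderHeterogeneity H ζ)
    (hη : 0 < η) (hμ : 0 < μ) (hημ : η * μ ≤ 1 / 4) (hηH : 8 * (η * H) ≤ 1)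
    {y : Vec d} (hy : y ∈ P.optima) (hyB : ‖y‖ ≤ B)
    (he₂ : 3 * K * (2 * K * (η * (H * ζ)) ^ 2 + η ^ 2 * σ₂ ^ 2) ≤ e₂)
    (he₄ : 27 * K * (2 * K * (2 * K * (η * (H * ζ)) ^ 2 + 5 * η ^ 2 * σ₂ ^ 2) ^ 2
        + 2 * η ^ 4 * σ₄ ^ 4) ≤ e₄) :
    Integrable (fun ω => P.avg ((P.regularize μ).weightedIterate η μ K R fun t m => z t m ω)) ν ∧
    ∫ ω, P.avg ((P.regularize μ).weightedIterate η μ K R fun t m => z t m ω) ∂ν - P.avg y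
      ≤ B ^ 2 / (η * (K * R)) + μ * B ^ 2 + 3 / μ * (2 * τ ^ 2 * e₂ + 2 * Q ^ 2 * e₄)
        + η * (σ₂ ^ 2 / M) := by
  let X : ℕ → Ω → Fin M → Vec d :=
    fun t ω => localSGD (P.regularize μ).grad η K (fun t m => z t m ω) t
  have step := hz.integral_norm_sub_sq_succ_le hM hK hH hQ h1 h2 h3 h4 h5 h7 h8 hη hμ hημ hηH hy
    hyB he₂ he₄ X fun _ _ => rfl
  have hX0 : ∀ ω, famMean (X 0 ω) = 0 := fun ω => famMean_const hM 0
  have hD : ∀ t, Integrable (fun ω => ‖famMean (X t ω) - y‖ ^ 2) ν := fun t => by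
    induction t with
    | zero => simp [hX0]
    | succ t ih => exact (step t ih).2.1
  have hδ := fun t => (step t (hD t)).1
  have hn : 0 < K * R := Nat.mul_pos hK hR
  have hr : 0 < 1 - η * μ / 2 := by linarith
  have hr1 : 1 - η * μ / 2 ≤ 1 := by nlinarith
  have main := weighted_average_le_of_contraction (D := fun t => ∫ ω, ‖famMean (X t ω) - y‖ ^ 2 ∂ν)
    (δ := fun t => ∫ ω, P.avg (famMean (X t ω)) - P.avg y ∂ν) hr hr1 hη
    (fun t => integral_nonneg fun ω => sq_nonneg _) (fun t => (step t (hD t)).2.2) hn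
  set n := K * R with hnKR
  set r := 1 - η * μ / 2
  set W := ∑ t ∈ Finset.range n, r ^ (n - 1 - t)
  have hW : 0 < W := Finset.sum_pos (fun t _ => by positivity) ⟨0, Finset.mem_range.2 hn⟩
  set xhat : Ω → Vec d := fun ω => (P.regularize μ).weightedIterate η μ K R fun t m => z t m ω
  have hle : ∀ ω, P.avg (xhat ω) - P.avg y ≤
      (1 / W) * ∑ t ∈ Finset.range n, r ^ (n - 1 - t) * (P.avg (famMean (X t ω)) - P.avg y) :=
    fun ω => h1.avg_weighted_le (Finset.range n) (fun t _ => by positivity) hW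
      (fun t => famMean (X t ω)) (P.avg y)
  have hsum : ∀ t ∈ Finset.range n,
      Integrable (fun ω => r ^ (n - 1 - t) * (P.avg (famMean (X t ω)) - P.avg y)) ν :=
    fun t _ => (hδ t).const_mul _
  have hbd := (integrable_finsetSum _ hsum).const_mul (1 / W)
  have hxm : Measurable xhat := by
    have : ∀ t, Measurable fun ω => famMean (X t ω) := fun t =>
      continuous_famMean.measurable.comp
        (hz.measurable_iterate (P.regularize μ).measurable_grad η K t)
    exact (Finset.measurable_sum _ fun t _ => (this t).const_smul (r ^ (n - 1 - t))).const_smul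
      (1 / W)
  have hint : Integrable (fun ω => P.avg (xhat ω) - P.avg y) ν :=
    hbd.mono' ((P.continuous_avg.measurable.comp hxm).sub_const _).aestronglyMeasurable
      (.of_forall fun ω => by rw [Real.norm_of_nonneg (sub_nonneg.2 (hy _))]; exact hle ω)
  have hint' : Integrable (fun ω => P.avg (xhat ω)) ν :=
    (hint.add (integrable_const (P.avg y))).congr (.of_forall fun ω => sub_add_cancel _ _)
  refine ⟨hint', ?_⟩
  have e : ∫ ω, P.avg (xhat ω) ∂ν - P.avg y = ∫ ω, P.avg (xhat ω) - P.avg y ∂ν := by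
    rw [integral_sub hint' (integrable_const _)]; simp
  rw [e]
  refine (integral_mono hint hbd hle).trans ?_
  rw [integral_const_mul, integral_finsetSum _ hsum]
  simp only [integral_const_mul]
  refine main.trans ?_
  have hB : ‖y‖ ^ 2 ≤ B ^ 2 := pow_le_pow_left₀ (norm_nonneg _) hyB 2
  simp only [hX0, zero_sub, norm_neg, integral_const, probReal_univ, one_smul, hnKR, Nat.cast_mul]
  have e2 : (η * μ * B ^ 2 + 3 * η / μ * (2 * τ ^ 2 * e₂ + 2 * Q ^ 2 * e₄)
      + η ^ 2 * (σ₂ ^ 2 / M)) / η = μ * B ^ 2 + 3 / μ * (2 * τ ^ 2 * e₂ + 2 * Q ^ 2 * e₄)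
        + η * (σ₂ ^ 2 / M) := by
    field_simp
  rw [e2, ← add_assoc, ← add_assoc]
  gcongr

end IsSampling

end FedProblem

/-! ### Choice of the step-size and of the regularization. -/

theorem rpow_pow_eq_pow {a : ℝ} (ha : 0 ≤ a) {p : ℝ} {n m : ℕ} (h : p * n = m) :
    (a ^ p) ^ n = a ^ m := by
  rw [← Real.rpow_natCast, ← Real.rpow_mul ha, h, Real.rpow_natCast]

/-- The error terms of Local SGD at step-size `1 / (μ K R)`, for large enough `μ`. -/
theorem local_error_terms_le {M K R H B Q τ ζ σ₂ σ₄ μ η : ℝ} (hM : 0 < M) (hK : 0 < K)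
    (hR : 0 < R) (hμ : 0 < μ) (hη : η = 1 / (μ * (K * R)))
    (a1 : τ ^ 2 * H ^ 2 * ζ ^ 2 / R ^ 2 ≤ B ^ 2 * μ ^ 4)
    (a2 : τ ^ 2 * σ₂ ^ 2 / (K * R ^ 2) ≤ B ^ 2 * μ ^ 4)
    (a3 : Q ^ 2 * H ^ 4 * ζ ^ 4 / R ^ 4 ≤ B ^ 2 * μ ^ 6)
    (a4 : Q ^ 2 * σ₂ ^ 4 / (K ^ 2 * R ^ 4) ≤ B ^ 2 * μ ^ 6)
    (a5 : Q ^ 2 * σ₄ ^ 4 / (K ^ 3 * R ^ 4) ≤ B ^ 2 * μ ^ 6)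
    (a6 : σ₂ ^ 2 / (M * K * R) ≤ B ^ 2 * μ ^ 2) :
    B ^ 2 / (η * (K * R)) + μ * B ^ 2
      + 3 / μ * (2 * τ ^ 2 * (3 * K * (2 * K * (η * (H * ζ)) ^ 2 + η ^ 2 * σ₂ ^ 2))
        + 2 * Q ^ 2 * (27 * K * (2 * K * (2 * K * (η * (H * ζ)) ^ 2 + 5 * η ^ 2 * σ₂ ^ 2) ^ 2
          + 2 * η ^ 4 * σ₄ ^ 4)))
      + η * (σ₂ ^ 2 / M) ≤ 20000 * (μ * B ^ 2) := by
  have t1 : B ^ 2 / (η * (K * R)) = μ * B ^ 2 := by rw [hη]; field_simp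
  have t2 : 3 / μ * (2 * τ ^ 2 * (3 * K * (2 * K * (η * (H * ζ)) ^ 2 + η ^ 2 * σ₂ ^ 2)))
      ≤ 54 * (μ * B ^ 2) := by
    calc _ = (36 * (τ ^ 2 * H ^ 2 * ζ ^ 2 / R ^ 2) + 18 * (τ ^ 2 * σ₂ ^ 2 / (K * R ^ 2)))
          / μ ^ 3 := by rw [hη]; field_simp; ring
      _ ≤ (36 * (B ^ 2 * μ ^ 4) + 18 * (B ^ 2 * μ ^ 4)) / μ ^ 3 := by gcongr
      _ = _ := by field_simp; ring
  have q : (2 * K * (η * (H * ζ)) ^ 2 + 5 * η ^ 2 * σ₂ ^ 2) ^ 2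
      ≤ 8 * K ^ 2 * η ^ 4 * H ^ 4 * ζ ^ 4 + 50 * η ^ 4 * σ₂ ^ 4 := by
    nlinarith [sq_nonneg (2 * K * (η * (H * ζ)) ^ 2 - 5 * η ^ 2 * σ₂ ^ 2)]
  have t3 : 3 / μ * (2 * Q ^ 2 * (27 * K * (2 * K * (2 * K * (η * (H * ζ)) ^ 2
      + 5 * η ^ 2 * σ₂ ^ 2) ^ 2 + 2 * η ^ 4 * σ₄ ^ 4))) ≤ 19116 * (μ * B ^ 2) := by
    calc _ ≤ 3 / μ * (2 * Q ^ 2 * (27 * K * (2 * K * (8 * K ^ 2 * η ^ 4 * H ^ 4 * ζ ^ 4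
          + 50 * η ^ 4 * σ₂ ^ 4) + 2 * η ^ 4 * σ₄ ^ 4))) := by gcongr
      _ = (2592 * (Q ^ 2 * H ^ 4 * ζ ^ 4 / R ^ 4) + 16200 * (Q ^ 2 * σ₂ ^ 4 / (K ^ 2 * R ^ 4))
          + 324 * (Q ^ 2 * σ₄ ^ 4 / (K ^ 3 * R ^ 4))) / μ ^ 5 := by rw [hη]; field_simp; ring
      _ ≤ (2592 * (B ^ 2 * μ ^ 6) + 16200 * (B ^ 2 * μ ^ 6) + 324 * (B ^ 2 * μ ^ 6)) / μ ^ 5 := by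
          gcongr
      _ = _ := by field_simp; ring
  have t4 : η * (σ₂ ^ 2 / M) ≤ μ * B ^ 2 := by
    calc _ = σ₂ ^ 2 / (M * K * R) / μ := by rw [hη]; field_simp
      _ ≤ B ^ 2 * μ ^ 2 / μ := by gcongr
      _ = _ := by field_simp
  have h0 : 0 ≤ μ * B ^ 2 := by positivity
  rw [t1, mul_add]
  linarith

/-- Trades a target term `T` with fractional exponents for the polynomial inequality that
`local_error_terms_le` needs, by raising `T ≤ B ^ 2 * μ` to the power that clears the roots. -/
theorem div_le_of_pow_le {x B S μ : ℝ} {k : ℕ} (hB : 0 < B) {T : ℝ} (hT : 0 ≤ T)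
    (hTS : T ≤ S) (hS : 8 * S = B ^ 2 * μ) (h : T ^ (k + 1) = x * B ^ (2 * k)) :
    x ≤ B ^ 2 * μ ^ (k + 1) := by
  have h1 : T ^ (k + 1) ≤ (B ^ 2 * μ) ^ (k + 1) := pow_le_pow_left₀ hT (by linarith) _
  have h2 : x * B ^ (2 * k) ≤ B ^ 2 * μ ^ (k + 1) * B ^ (2 * k) := by
    rw [← h]
    refine h1.trans_eq ?_
    rw [mul_pow, ← pow_mul]
    ring
  exact le_of_mul_le_mul_right h2 (by positivity)

set_option maxHeartbeats 2000000 in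
theorem mainTheorem6 :
    ∃ c C : ℝ, 0 < c ∧ 0 < C ∧
    ∀ (M K R : ℕ) (H B Q τ ζ σ₂ σ₄ : ℝ),
      0 < M → 0 < K → 0 < R → 0 < H → 0 < B →
      0 ≤ Q → 0 ≤ τ → 0 ≤ ζ → 0 ≤ σ₂ → 0 ≤ σ₄ →
      c * (1 / (K : ℝ) + σ₂ ^ 2 / (H ^ 2 * B ^ 2 * M * K) + τ * ζ / (B * H)
          + Q * ζ ^ 2 / (H * B) + τ * σ₂ / (H ^ 2 * B * √(K : ℝ))
          + σ₂ * Q ^ (1 / 2 : ℝ) / (H ^ (3 / 2 : ℝ) * √(B * K))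
          + Q ^ (1 / 2 : ℝ) * σ₄ / (H ^ (3 / 2 : ℝ) * √B * (K : ℝ) ^ (3 / 4 : ℝ))) ≤ (R : ℝ) →
      ∃ η μ : ℝ, 0 < η ∧ 0 < μ ∧ η * μ < 2 ∧
      ∀ (d : ℕ) (Z : Type*) [MeasurableSpace Z] (P : FedProblem d M Z),
        P.Convex → P.SecondOrderSmooth H → P.ThirdOrderSmooth Q →
        P.BoundedSecondMoment σ₂ → P.BoundedFourthMoment σ₄ → P.BoundedOptima B →
        P.SecondOrderHeterogeneity τ → P.UniformFirstOrderHeterogeneity H ζ →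
      ∀ (Ω : Type*) [MeasurableSpace Ω] (ν : Measure Ω) [IsProbabilityMeasure ν]
        (z : ℕ → Fin M → Ω → Z), P.IsSampling ν z →
      ∀ xhat : Ω → Vec d,
        (∀ ω, xhat ω = (P.regularize μ).weightedIterate η μ K R (fun t m => z t m ω)) →
        Integrable (fun ω => P.avg (xhat ω)) ν ∧
        ∀ xstar ∈ P.optima,
          (∫ ω, P.avg (xhat ω) ∂ν) - P.avg xstar ≤
            C * (1 + Real.log ((K : ℝ) * R)) *
              (H * B ^ 2 / (K * R)
                + τ ^ (1 / 2 : ℝ) * H ^ (1 / 2 : ℝ) * ζ ^ (1 / 2 : ℝ) * B ^ (3 / 2 : ℝ)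
                    / (R : ℝ) ^ (1 / 2 : ℝ)
                + τ ^ (1 / 2 : ℝ) * σ₂ ^ (1 / 2 : ℝ) * B ^ (3 / 2 : ℝ)
                    / ((K : ℝ) ^ (1 / 4 : ℝ) * (R : ℝ) ^ (1 / 2 : ℝ))
                + Q ^ (1 / 3 : ℝ) * B ^ (5 / 3 : ℝ) * H ^ (2 / 3 : ℝ) * ζ ^ (2 / 3 : ℝ)
                    / (R : ℝ) ^ (2 / 3 : ℝ)
                + Q ^ (1 / 3 : ℝ) * B ^ (5 / 3 : ℝ) * σ₂ ^ (2 / 3 : ℝ)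
                    / ((K : ℝ) ^ (1 / 3 : ℝ) * (R : ℝ) ^ (2 / 3 : ℝ))
                + Q ^ (1 / 3 : ℝ) * B ^ (5 / 3 : ℝ) * σ₄ ^ (2 / 3 : ℝ)
                    / ((K : ℝ) ^ (1 / 2 : ℝ) * (R : ℝ) ^ (2 / 3 : ℝ))
                + σ₂ * B / √((M : ℝ) * K * R)) := by
  -- The 4 forces `K * R ≥ 4`, that is `η * μ ≤ 1 / 4`; 160000 is 20000 times the 8 in `μ`.
  refine ⟨4, 160000, by norm_num, by norm_num, ?_⟩
  intro M K R H B Q τ ζ σ₂ σ₄ hM hK hR hH hB hQ hτ hζ hσ₂ hσ₄ hc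
  have hM' : (0 : ℝ) < M := by exact_mod_cast hM
  have hK' : (0 : ℝ) < K := by exact_mod_cast hK
  have hR' : (0 : ℝ) < R := by exact_mod_cast hR
  have hKR : (4 : ℝ) ≤ K * R := by
    have h1 : 4 * (1 / (K : ℝ)) ≤ R := by
      refine le_trans ?_ hc
      simp only [add_assoc]
      gcongr
      exact le_add_of_nonneg_right (by positivity)
    rw [mul_one_div, div_le_iff₀ hK'] at h1
    linarith
  set T₁ := H * B ^ 2 / (K * R) with hT₁
  set T₂ := τ ^ (1 / 2 : ℝ) * H ^ (1 / 2 : ℝ) * ζ ^ (1 / 2 : ℝ) * B ^ (3 / 2 : ℝ)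
    / (R : ℝ) ^ (1 / 2 : ℝ) with hT₂
  set T₃ := τ ^ (1 / 2 : ℝ) * σ₂ ^ (1 / 2 : ℝ) * B ^ (3 / 2 : ℝ)
    / ((K : ℝ) ^ (1 / 4 : ℝ) * (R : ℝ) ^ (1 / 2 : ℝ)) with hT₃
  set T₄ := Q ^ (1 / 3 : ℝ) * B ^ (5 / 3 : ℝ) * H ^ (2 / 3 : ℝ) * ζ ^ (2 / 3 : ℝ)
    / (R : ℝ) ^ (2 / 3 : ℝ) with hT₄
  set T₅ := Q ^ (1 / 3 : ℝ) * B ^ (5 / 3 : ℝ) * σ₂ ^ (2 / 3 : ℝ)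
    / ((K : ℝ) ^ (1 / 3 : ℝ) * (R : ℝ) ^ (2 / 3 : ℝ)) with hT₅
  set T₆ := Q ^ (1 / 3 : ℝ) * B ^ (5 / 3 : ℝ) * σ₄ ^ (2 / 3 : ℝ)
    / ((K : ℝ) ^ (1 / 2 : ℝ) * (R : ℝ) ^ (2 / 3 : ℝ)) with hT₆
  set T₇ := σ₂ * B / √((M : ℝ) * K * R) with hT₇
  have p₁ : 0 < T₁ := by positivity
  have p₂ : 0 ≤ T₂ := by positivity
  have p₃ : 0 ≤ T₃ := by positivity
  have p₄ : 0 ≤ T₄ := by positivity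
  have p₅ : 0 ≤ T₅ := by positivity
  have p₆ : 0 ≤ T₆ := by positivity
  have p₇ : 0 ≤ T₇ := by positivity
  set S := T₁ + T₂ + T₃ + T₄ + T₅ + T₆ + T₇ with hSdef
  have hS : 0 < S := by positivity
  -- The summand `T₁` of `S` together with the factor 8 gives `8 * (η * H) ≤ 1`; the other summands
  -- control the error terms.
  set μ := 8 * S / B ^ 2 with hμdef
  have hμ : 0 < μ := by positivity
  have hSμ : 8 * S = B ^ 2 * μ := by rw [hμdef]; field_simp
  set η := 1 / (μ * (K * R)) with hη
  have hη0 : 0 < η := by positivity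
  have hημ : η * μ ≤ 1 / 4 := by
    have : η * μ = 1 / (K * R) := by rw [hη]; field_simp
    rw [this]
    exact one_div_le_one_div_of_le (by norm_num) hKR
  have hηH : 8 * (η * H) ≤ 1 := by
    have h1 : T₁ ≤ S := by linarith
    have h2 : 8 * H ≤ μ * (K * R) := by
      rw [hT₁, div_le_iff₀ (by positivity)] at h1
      have : B ^ 2 * (8 * H) ≤ B ^ 2 * (μ * (K * R)) := by
        rw [← mul_assoc (B ^ 2) μ, ← hSμ]; linarith
      exact le_of_mul_le_mul_left this (by positivity)
    rw [hη, one_div, ← div_eq_inv_mul, ← mul_div_assoc, div_le_one (by positivity)]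
    exact h2
  have a1 : τ ^ 2 * H ^ 2 * ζ ^ 2 / R ^ 2 ≤ B ^ 2 * μ ^ 4 := by
    refine div_le_of_pow_le hB p₂ (by linarith) hSμ (k := 3) ?_
    rw [hT₂]
    simp only [div_pow, mul_pow]
    rw [rpow_pow_eq_pow hτ (m := 2) (by norm_num), rpow_pow_eq_pow hH.le (m := 2) (by norm_num),
      rpow_pow_eq_pow hζ (m := 2) (by norm_num), rpow_pow_eq_pow hB.le (m := 6) (by norm_num),
      rpow_pow_eq_pow hR'.le (m := 2) (by norm_num)]
    ring
  have a2 : τ ^ 2 * σ₂ ^ 2 / (K * R ^ 2) ≤ B ^ 2 * μ ^ 4 := by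
    refine div_le_of_pow_le hB p₃ (by linarith) hSμ (k := 3) ?_
    rw [hT₃]
    simp only [div_pow, mul_pow]
    rw [rpow_pow_eq_pow hτ (m := 2) (by norm_num), rpow_pow_eq_pow hσ₂ (m := 2) (by norm_num),
      rpow_pow_eq_pow hB.le (m := 6) (by norm_num), rpow_pow_eq_pow hK'.le (m := 1) (by norm_num),
      rpow_pow_eq_pow hR'.le (m := 2) (by norm_num)]
    ring
  have a3 : Q ^ 2 * H ^ 4 * ζ ^ 4 / R ^ 4 ≤ B ^ 2 * μ ^ 6 := by
    refine div_le_of_pow_le hB p₄ (by linarith) hSμ (k := 5) ?_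
    rw [hT₄]
    simp only [div_pow, mul_pow]
    rw [rpow_pow_eq_pow hQ (m := 2) (by norm_num), rpow_pow_eq_pow hB.le (m := 10) (by norm_num),
      rpow_pow_eq_pow hH.le (m := 4) (by norm_num), rpow_pow_eq_pow hζ (m := 4) (by norm_num),
      rpow_pow_eq_pow hR'.le (m := 4) (by norm_num)]
    ring
  have a4 : Q ^ 2 * σ₂ ^ 4 / (K ^ 2 * R ^ 4) ≤ B ^ 2 * μ ^ 6 := by
    refine div_le_of_pow_le hB p₅ (by linarith) hSμ (k := 5) ?_
    rw [hT₅]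
    simp only [div_pow, mul_pow]
    rw [rpow_pow_eq_pow hQ (m := 2) (by norm_num), rpow_pow_eq_pow hB.le (m := 10) (by norm_num),
      rpow_pow_eq_pow hσ₂ (m := 4) (by norm_num), rpow_pow_eq_pow hK'.le (m := 2) (by norm_num),
      rpow_pow_eq_pow hR'.le (m := 4) (by norm_num)]
    ring
  have a5 : Q ^ 2 * σ₄ ^ 4 / (K ^ 3 * R ^ 4) ≤ B ^ 2 * μ ^ 6 := by
    refine div_le_of_pow_le hB p₆ (by linarith) hSμ (k := 5) ?_
    rw [hT₆]
    simp only [div_pow, mul_pow]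
    rw [rpow_pow_eq_pow hQ (m := 2) (by norm_num), rpow_pow_eq_pow hB.le (m := 10) (by norm_num),
      rpow_pow_eq_pow hσ₄ (m := 4) (by norm_num), rpow_pow_eq_pow hK'.le (m := 3) (by norm_num),
      rpow_pow_eq_pow hR'.le (m := 4) (by norm_num)]
    ring
  have a6 : σ₂ ^ 2 / (M * K * R) ≤ B ^ 2 * μ ^ 2 := by
    refine div_le_of_pow_le hB p₇ (by linarith) hSμ (k := 1) ?_
    rw [hT₇, div_pow, mul_pow, Real.sq_sqrt (by positivity)]
    ring
  refine ⟨η, μ, hη0, hμ, by linarith, ?_⟩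
  intro d Z _ P h1 h2 h3 h4 h5 h6 h7 h8 Ω _ ν _ z hz xhat hxhat
  obtain ⟨y, hy, hyB⟩ := h6.2
  obtain ⟨hint, hbound⟩ := hz.integral_avg_weightedIterate_sub_le hM hK hR hH hQ h1 h2 h3 h4 h5 h7
    h8 hη0 hμ hημ hηH hy hyB le_rfl le_rfl
  simp only [hxhat]
  refine ⟨hint, fun xstar hxstar => ?_⟩
  -- All minimizers share one value, so the estimate for the minimizer of norm at most `B` covers
  -- `xstar`.
  rw [le_antisymm (hxstar y) (hy xstar)]
  refine (hbound.trans (local_error_terms_le hM' hK' hR' hμ hη a1 a2 a3 a4 a5 a6)).trans ?_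
  have hlog : 0 ≤ Real.log ((K : ℝ) * R) := Real.log_nonneg (by linarith)
  have h160 : 20000 * (μ * B ^ 2) = 160000 * 1 * S := by linarith
  rw [h160]
  gcongr
  linarith
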